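/- Let $H$ be a complex Hilbert space and let $M\subseteq \mathbb{B}(H)$ be a von Neumann algebra containing $1_H$. For a $*$-subalgebra $N\subseteq M$ put $\mathcal{N}_M(N):=\{u\in U(M): uNu^*=N\}$, and call $N$ regular in the von Neumann algebra $M$ if $\mathcal{N}_M(N)''=M$. For a $*$-subalgebra $C$ of a C*-algebra $B$ put $N_B(C):=\{n\in B: nCn^*\cup n^*Cn\subseteq C\}$, and call $C$ regular in the C*-algebra $B$ if $N_B(C)$ generates $B$ as a C*-algebra. A von Neumann algebra is diffuse if it has no minimal projections, and $M$ is amenable (injective) if there is a linear projection of norm at most one from $\mathbb{B}(H)$ onto $M$. The von Neumann algebra $M$ is strongly solid if $\mathcal{N}_M(A)''$ is amenable for every diffuse amenable von Neumann subalgebra $A\subseteq M$ with $1_M\in A$. Corollary 2.3. Let $M$ be a non-amenable strongly solid type II$_1$ factor. Then no strongly dense C*-subalgebra $B\subseteq M$ (unital or not) has an infinite dimensional abelian $*$-subalgebra $C\subseteq B$ that is regular in the C*-algebra $B$. Likewise $M$ itself has no infinite dimensional abelian $*$-subalgebra that is regular in the von Neumann algebra $M$. The $*$-subalgebras here need not be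 closed or unital. -/

import Mathlib

namespace OpAlg

variable {H : Type*} [NormedAddCommGroup H] [InnerProductSpace ℂ H] [CompleteSpace H]

/-- The von Neumann algebra `(S ∪ S*)''` on `H` generated by a set `S` of bounded operators. For a
set closed under the adjoint (such as a group of unitaries) this is the double commutant `S''`. -/
noncomputable def generatedVN (S : Set (H →L[ℂ] H)) : VonNeumannAlgebra H where
  toStarSubalgebra :=
    StarSubalgebra.centralizer ℂ (StarSubalgebra.centralizer ℂ S : Set (H →L[ℂ] H))
  centralizer_centralizer' := by
    change Set.centralizer (Set.centralizer
      ((StarSubalgebra.centralizer ℂ (StarSubalgebra.centralizer ℂ S : Set (H →L[ℂ] H)) :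
        StarSubalgebra ℂ (H →L[ℂ] H)) : Set (H →L[ℂ] H))) =
      ((StarSubalgebra.centralizer ℂ (StarSubalgebra.centralizer ℂ S : Set (H →L[ℂ] H)) :
        StarSubalgebra ℂ (H →L[ℂ] H)) : Set (H →L[ℂ] H))
    rw [StarSubalgebra.coe_centralizer, Set.centralizer_centralizer_centralizer]

/-- A nonzero orthogonal projection of the von Neumann algebra `M` is minimal if its only
subprojections in `M` are `0` and itself (`q * p = q` says that `q ≤ p`). -/
def IsMinimalProjection (M : VonNeumannAlgebra H) (p : H →L[ℂ] H) : Prop :=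
  p ∈ M ∧ IsStarProjection p ∧ p ≠ 0 ∧
    ∀ q ∈ M, IsStarProjection q → q * p = q → q = 0 ∨ q = p

/-- A von Neumann algebra is diffuse if it has no minimal projections. -/
def IsDiffuse (M : VonNeumannAlgebra H) : Prop :=
  ∀ p, ¬ IsMinimalProjection M p

/-- A factor: a nonzero von Neumann algebra whose center consists of the scalars. -/
def IsFactor (M : VonNeumannAlgebra H) : Prop :=
  (1 : H →L[ℂ] H) ≠ 0 ∧ ∀ x ∈ M, x ∈ M.commutant → ∃ c : ℂ, x = c • (1 : H →L[ℂ] H)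

/-- Finiteness in the sense of Murray and von Neumann: every isometry in `M` is unitary. -/
def IsFiniteVN (M : VonNeumannAlgebra H) : Prop :=
  ∀ v ∈ M, star v * v = 1 → v * star v = 1

/-- A type II₁ factor: a finite factor without minimal projections (a factor is of type I exactly
when it has a minimal projection). -/
def IsTypeIIOneFactor (M : VonNeumannAlgebra H) : Prop :=
  IsFactor M ∧ IsFiniteVN M ∧ IsDiffuse M

/-- Amenability (also called injectivity) of a von Neumann algebra `M` on `H`: there is a
projection of norm at most one (a conditional expectation) from `B(H)` onto `M`. -/
def IsAmenable (M : VonNeumannAlgebra H) : Prop :=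
  ∃ E : (H →L[ℂ] H) →ₗ[ℂ] (H →L[ℂ] H),
    (∀ x, ‖E x‖ ≤ ‖x‖) ∧ (∀ x, E x ∈ M) ∧ ∀ x ∈ M, E x = x

/-- The normalizer of `N` in the von Neumann algebra `M`: the unitaries `u` of `M` with
`u N u* = N`. -/
def unitaryNormalizer (M : VonNeumannAlgebra H) (N : Set (H →L[ℂ] H)) : Set (H →L[ℂ] H) :=
  {u | u ∈ M ∧ u ∈ unitary (H →L[ℂ] H) ∧ (fun x => u * x * star u) '' N = N}

/-- Strong solidity: the normalizer of any diffuse amenable (unital) von Neumann subalgebra of `M`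
generates an amenable von Neumann algebra. -/
def IsStronglySolid (M : VonNeumannAlgebra H) : Prop :=
  ∀ A : VonNeumannAlgebra H, A ≤ M → IsDiffuse A → IsAmenable A →
    IsAmenable (generatedVN (unitaryNormalizer M (A : Set (H →L[ℂ] H))))

/-- Regularity of a `*`-subalgebra of a von Neumann algebra: its unitary normalizer generates `M`
as a von Neumann algebra. -/
def IsRegularVN (M : VonNeumannAlgebra H) (N : NonUnitalStarSubalgebra ℂ (H →L[ℂ] H)) : Prop :=
  (N : Set (H →L[ℂ] H)) ⊆ M ∧ generatedVN (unitaryNormalizer M (N : Set (H →L[ℂ] H))) = M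

/-- A C*-subalgebra `B` of operators on `H` (not assumed to contain the identity) that is contained
in `M` and dense in `M` for the strong operator topology. -/
def IsStronglyDenseCStarSubalgebra (M : VonNeumannAlgebra H)
    (B : NonUnitalStarSubalgebra ℂ (H →L[ℂ] H)) : Prop :=
  IsClosed (B : Set (H →L[ℂ] H)) ∧ (B : Set (H →L[ℂ] H)) ⊆ M ∧
    ∀ x ∈ M, ContinuousLinearMap.toPointwiseConvergenceCLM ℂ (RingHom.id ℂ) H H x ∈
      closure (ContinuousLinearMap.toPointwiseConvergenceCLM ℂ (RingHom.id ℂ) H H ''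
        (B : Set (H →L[ℂ] H)))

/-- The C*-algebraic normalizer of `C` in `B`: the `n ∈ B` with `n C n* ∪ n* C n ⊆ C`. -/
def cstarNormalizer (B C : NonUnitalStarSubalgebra ℂ (H →L[ℂ] H)) : Set (H →L[ℂ] H) :=
  {n | n ∈ B ∧ ∀ c ∈ C, n * c * star n ∈ C ∧ star n * c * n ∈ C}

/-- Regularity of a `*`-subalgebra `C` of a C*-algebra `B`: the norm-closed `*`-algebra generated
by the normalizer of `C` in `B` is `B`. -/
def IsRegularCStar (B C : NonUnitalStarSubalgebra ℂ (H →L[ℂ] H)) : Prop :=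
  C ≤ B ∧ (NonUnitalStarAlgebra.adjoin ℂ (cstarNormalizer B C)).topologicalClosure = B

/-- Commutativity of a `*`-subalgebra. -/
def IsAbelian (C : NonUnitalStarSubalgebra ℂ (H →L[ℂ] H)) : Prop :=
  ∀ x ∈ C, ∀ y ∈ C, x * y = y * x

end OpAlg

namespace OpAlg

variable {H : Type*} [NormedAddCommGroup H] [InnerProductSpace ℂ H] [CompleteSpace H]

open Filter Topology

/-! Put `A = C''`, an abelian von Neumann subalgebra of `M`; it is amenable by
`isAmenable_of_isAbelianVN`. Two facts remain: the normalizing unitaries of `A` generate `M`, and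
`A` is diffuse when `C` is infinite dimensional. Strong solidity then makes `M` amenable, a
contradiction.

Diffuseness (`exists_finiteDimensional_of_isMinimalProjection`): conjugating a minimal projection of
`A` by the normalizing unitaries gives pairwise orthogonal projections, all equivalent in `M`. An
infinite orbit would produce a non-unitary isometry (`IsFiniteVN.eq_zero_of_shift`). The sum of a
finite orbit is central in `M`, hence `1`, and then `A` is spanned by the orbit.

Regularity: a unitary normalizing `C` also normalizes `C''`, which settles the von Neumann case. In
the C*-case the normalizers `n` need not be unitary. Since `C` acts nondegenerately, it is weakly
dense enough in `A` for `n` to normalize `A` (`conj_mem_generatedVN`). Cut-offs of the polar part of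
`n` are partial isometries normalizing `A`, and these are controlled by pieces that extend to
normalizing unitaries (`commute_of_partialIsometry`). So `n` lies in the bicommutant of those
unitaries (`commute_of_normalizes`), and the `n` generate `M`. -/

/-! ### Von Neumann algebras through their commutants -/

theorem mem_of_commute {M : VonNeumannAlgebra H} {x : H →L[ℂ] H}
    (h : ∀ y ∈ M.commutant, y * x = x * y) : x ∈ M := by
  rw [← VonNeumannAlgebra.commutant_commutant M]
  exact VonNeumannAlgebra.mem_commutant_iff.2 h

theorem commute_of_mem {M : VonNeumannAlgebra H} {x y : H →L[ℂ] H} (hx : x ∈ M)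
    (hy : y ∈ M.commutant) : y * x = x * y :=
  (VonNeumannAlgebra.mem_commutant_iff.1 hy x hx).symm

theorem smul_mem (M : VonNeumannAlgebra H) (c : ℂ) {x : H →L[ℂ] H} (hx : x ∈ M) : c • x ∈ M :=
  M.toStarSubalgebra.smul_mem hx c

theorem isClosed_vN (M : VonNeumannAlgebra H) : IsClosed (M : Set (H →L[ℂ] H)) := by
  rw [← VonNeumannAlgebra.centralizer_centralizer M]
  exact Set.isClosed_centralizer _

theorem cfc_mem_vN (M : VonNeumannAlgebra H) (f : ℝ → ℝ) {x : H →L[ℂ] H} (hx : x ∈ M) :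
    cfc f x ∈ M := by
  have hc : IsClosed (M.toStarSubalgebra : Set (H →L[ℂ] H)) := isClosed_vN M
  exact cfc_mem (𝕜' := ℂ) (s := M.toStarSubalgebra) (hs := hc) f hx

theorem subset_generatedVN (S : Set (H →L[ℂ] H)) : S ⊆ generatedVN S := by
  intro s hs
  change s ∈ StarSubalgebra.centralizer ℂ (StarSubalgebra.centralizer ℂ S : Set (H →L[ℂ] H))
  rw [StarSubalgebra.mem_centralizer_iff]
  intro y hy
  refine ⟨((StarSubalgebra.mem_centralizer_iff ℂ).1 hy s hs).1.symm, ?_⟩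
  have := ((StarSubalgebra.mem_centralizer_iff ℂ).1 hy s hs).2
  have := congrArg star this
  simpa using this

theorem mem_generatedVN {S : Set (H →L[ℂ] H)} {x : H →L[ℂ] H} :
    x ∈ generatedVN S ↔
      ∀ y, (∀ s ∈ S, s * y = y * s ∧ star s * y = y * star s) → y * x = x * y := by
  change x ∈ StarSubalgebra.centralizer ℂ (StarSubalgebra.centralizer ℂ S : Set (H →L[ℂ] H)) ↔ _
  rw [StarSubalgebra.mem_centralizer_iff]
  constructor
  · intro h y hy
    exact (h y ((StarSubalgebra.mem_centralizer_iff ℂ).2 hy)).1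
  · intro h y hy
    exact ⟨h y ((StarSubalgebra.mem_centralizer_iff ℂ).1 hy),
      h (star y) ((StarSubalgebra.mem_centralizer_iff ℂ).1 (star_mem hy))⟩

theorem mem_commutant_generatedVN {S : Set (H →L[ℂ] H)} {y : H →L[ℂ] H}
    (hy : ∀ s ∈ S, s * y = y * s ∧ star s * y = y * star s) : y ∈ (generatedVN S).commutant :=
  VonNeumannAlgebra.mem_commutant_iff.2 fun _ hx => (mem_generatedVN.1 hx y hy).symm

theorem generatedVN_le {S : Set (H →L[ℂ] H)} {M : VonNeumannAlgebra H} (h : S ⊆ M) :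
    generatedVN S ≤ M := by
  intro x hx
  refine mem_of_commute fun y hy => mem_generatedVN.1 hx y fun s hs => ?_
  exact ⟨(commute_of_mem (h hs) hy).symm, (commute_of_mem (star_mem (h hs)) hy).symm⟩

theorem generatedVN_mono {S T : Set (H →L[ℂ] H)} (h : S ⊆ T) : generatedVN S ≤ generatedVN T :=
  generatedVN_le (h.trans (subset_generatedVN T))

/-- Every family of elements of a von Neumann algebra has a left support projection in it. -/
theorem exists_supportProjection (A : VonNeumannAlgebra H) {S : Set (H →L[ℂ] H)}
    (hS : S ⊆ A) :
    ∃ R ∈ A, IsStarProjection R ∧ (∀ b ∈ S, R * b = b) ∧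
      ∀ T : H →L[ℂ] H, (∀ b ∈ S, T * b = 0) → T * R = 0 := by
  -- The projection is onto the closed span of all ranges of the `b ∈ S`; this subspace is invariant
  -- under the commutant of `A`, which puts its projection in `A`.
  let K₀ : Submodule ℂ H := Submodule.span ℂ {ξ | ∃ b ∈ S, ∃ η, ξ = b η}
  let K : Submodule ℂ H := K₀.topologicalClosure
  have hKc : IsClosed (K : Set H) := K₀.isClosed_topologicalClosure
  have : CompleteSpace K := hKc.completeSpace_coe
  refine ⟨K.starProjection, ?_, isStarProjection_starProjection, ?_, ?_⟩
  · rw [VonNeumannAlgebra.IsStarProjection.mem_iff isStarProjection_starProjection]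
    intro y hy
    rw [Submodule.range_starProjection]
    intro ξ hξ
    have h0 : K₀ ≤ K₀.comap y.toLinearMap := by
      refine Submodule.span_le.2 ?_
      rintro _ ⟨b, hb, η, rfl⟩
      refine Submodule.subset_span ⟨b, hb, y η, ?_⟩
      exact congrArg (fun t : H →L[ℂ] H => t η) (commute_of_mem (hS hb) hy)
    have h1 : K₀ ≤ K.comap y.toLinearMap := fun ζ hζ => K₀.le_topologicalClosure (h0 hζ)
    exact K₀.topologicalClosure_minimal h1 (hKc.preimage y.continuous) hξ
  · intro b hb
    ext η
    exact Submodule.starProjection_eq_self_iff.2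
      (K₀.le_topologicalClosure (Submodule.subset_span ⟨b, hb, η, rfl⟩))
  · intro T hT
    ext η
    have h0 : K₀ ≤ T.ker := by
      refine Submodule.span_le.2 ?_
      rintro _ ⟨b, hb, η, rfl⟩
      exact congrArg (fun t : H →L[ℂ] H => t η) (hT b hb)
    exact K₀.topologicalClosure_minimal h0 T.isClosed_ker (K.starProjection_apply_mem η)

/-- Commutativity of a von Neumann algebra. -/
def IsAbelianVN (A : VonNeumannAlgebra H) : Prop := ∀ x ∈ A, ∀ y ∈ A, x * y = y * x

/-- Since `C` is commutative and self-adjoint, `C''` commutes with `C`; so `C''` lies in `C'` and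
therefore commutes with itself. -/
theorem isAbelianVN_generatedVN {C : NonUnitalStarSubalgebra ℂ (H →L[ℂ] H)} (hC : IsAbelian C) :
    IsAbelianVN (generatedVN (C : Set (H →L[ℂ] H))) := by
  intro x hx y hy
  refine mem_generatedVN.1 hy x fun s hs => ?_
  have key : ∀ t ∈ C, t * x = x * t := fun t ht =>
    mem_generatedVN.1 hx t fun s hs => ⟨hC s hs t ht, hC _ (star_mem hs) t ht⟩
  exact ⟨key s hs, key _ (star_mem hs)⟩

/-! ### Normalizing unitaries -/

theorem mem_unitaryNormalizer_iff {M : VonNeumannAlgebra H} {N : Set (H →L[ℂ] H)}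
    {u : H →L[ℂ] H} :
    u ∈ unitaryNormalizer M N ↔ u ∈ M ∧ star u * u = 1 ∧ u * star u = 1 ∧
      (∀ a ∈ N, u * a * star u ∈ N) ∧ ∀ a ∈ N, star u * a * u ∈ N := by
  constructor
  · rintro ⟨hM, hu, hN⟩
    have h1 : star u * u = 1 := (Unitary.mem_iff.1 hu).1
    refine ⟨hM, h1, (Unitary.mem_iff.1 hu).2, fun a ha => ?_, fun a ha => ?_⟩
    · rw [← hN]; exact ⟨a, ha, rfl⟩
    · rw [← hN] at ha
      obtain ⟨b, hb, rfl⟩ := ha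
      have : star u * (u * b * star u) * u = (star u * u) * b * (star u * u) := by
        simp only [mul_assoc]
      simpa [this, h1] using hb
  · rintro ⟨hM, h1, h2, h3, h4⟩
    refine ⟨hM, Unitary.mem_iff.2 ⟨h1, h2⟩, Set.Subset.antisymm ?_ ?_⟩
    · rintro _ ⟨a, ha, rfl⟩; exact h3 a ha
    · intro a ha
      refine ⟨star u * a * u, h4 a ha, ?_⟩
      have : u * (star u * a * u) * star u = (u * star u) * a * (u * star u) := by
        simp only [mul_assoc]
      simp [this, h2]

theorem star_mem_unitaryNormalizer {M : VonNeumannAlgebra H} {N : Set (H →L[ℂ] H)}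
    {u : H →L[ℂ] H} (hu : u ∈ unitaryNormalizer M N) : star u ∈ unitaryNormalizer M N := by
  rw [mem_unitaryNormalizer_iff] at hu ⊢
  obtain ⟨h0, h1, h2, h3, h4⟩ := hu
  exact ⟨star_mem h0, by simpa using h2, by simpa using h1, by simpa using h4, by simpa using h3⟩

theorem mul_mem_unitaryNormalizer {M : VonNeumannAlgebra H} {N : Set (H →L[ℂ] H)}
    {u v : H →L[ℂ] H} (hu : u ∈ unitaryNormalizer M N) (hv : v ∈ unitaryNormalizer M N) :
    u * v ∈ unitaryNormalizer M N := by
  rw [mem_unitaryNormalizer_iff] at hu hv ⊢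
  obtain ⟨h0, h1, h2, h3, h4⟩ := hu
  obtain ⟨k0, k1, k2, k3, k4⟩ := hv
  refine ⟨mul_mem h0 k0, ?_, ?_, fun a ha => ?_, fun a ha => ?_⟩
  · rw [star_mul, mul_assoc, ← mul_assoc (star u), h1, one_mul, k1]
  · rw [star_mul, mul_assoc, ← mul_assoc v, k2, one_mul, h2]
  · simpa only [star_mul, mul_assoc] using h3 _ (k3 a ha)
  · simpa only [star_mul, mul_assoc] using k4 _ (h4 a ha)

theorem unitaryNormalizer_subset_generatedVN (M : VonNeumannAlgebra H) (N : Set (H →L[ℂ] H)) :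
    unitaryNormalizer M N ⊆ unitaryNormalizer M (generatedVN N : Set (H →L[ℂ] H)) := by
  -- Conjugation is moved onto `y`: since `u s u*` stays in `N`, the operator `u* y u` again
  -- commutes with `N` and its adjoints, so `a` commutes with it.
  have main : ∀ u ∈ unitaryNormalizer M N, ∀ a ∈ generatedVN N, u * a * star u ∈ generatedVN N := by
    intro u hu a ha
    obtain ⟨h0, h1, h2, h3, h4⟩ := mem_unitaryNormalizer_iff.1 hu
    refine mem_generatedVN.2 fun y hy => ?_
    have hcomm : ∀ s : H →L[ℂ] H, (u * s * star u) * y = y * (u * s * star u) →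
        s * (star u * y * u) = star u * y * u * s := by
      intro s hs
      calc s * (star u * y * u) = (star u * u) * (s * (star u * y * u)) := by rw [h1, one_mul]
        _ = star u * ((u * s * star u) * y) * u := by simp only [mul_assoc]
        _ = star u * (y * (u * s * star u)) * u := by rw [hs]
        _ = star u * y * u * s * (star u * u) := by simp only [mul_assoc]
        _ = _ := by rw [h1, mul_one]
    have key := mem_generatedVN.1 ha (star u * y * u) fun s hs => by
      refine ⟨hcomm s (hy _ (h3 s hs)).1, hcomm _ ?_⟩
      have := (hy _ (h3 s hs)).2
      simpa only [star_mul, star_star, mul_assoc] using this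
    calc y * (u * a * star u) = (u * star u) * (y * (u * a * star u)) := by rw [h2, one_mul]
      _ = u * ((star u * y * u) * a) * star u := by simp only [mul_assoc]
      _ = u * (a * (star u * y * u)) * star u := by rw [key]
      _ = u * a * star u * y * (u * star u) := by simp only [mul_assoc]
      _ = _ := by rw [h2, mul_one]
  intro u hu
  obtain ⟨h0, h1, h2, h3, h4⟩ := mem_unitaryNormalizer_iff.1 hu
  refine mem_unitaryNormalizer_iff.2 ⟨h0, h1, h2, main u hu, ?_⟩
  simpa using main _ (star_mem_unitaryNormalizer hu)

/-! ### Abelian von Neumann algebras are amenable -/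

/-- A bounded family of operators converges weakly along every ultrafilter. -/
theorem exists_weak_ultralimit {ι : Type*} (U : Ultrafilter ι) (T : ι → H →L[ℂ] H) {C : ℝ}
    (hC : 0 ≤ C) (hT : ∀ i, ‖T i‖ ≤ C) :
    ∃ S : H →L[ℂ] H, ‖S‖ ≤ C ∧
      ∀ ξ η, Tendsto (fun i => inner ℂ (T i ξ) η) U (𝓝 (inner ℂ (S ξ) η)) := by
  have hb : ∀ ξ η i, ‖inner ℂ (T i ξ) η‖ ≤ C * ‖ξ‖ * ‖η‖ := fun ξ η i =>
    (norm_inner_le_norm _ _).trans (by gcongr; exact (T i).le_of_opNorm_le (hT i) ξ)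
  have hex : ∀ ξ η, ∃ z : ℂ, Tendsto (fun i => inner ℂ (T i ξ) η) U (𝓝 z) := by
    intro ξ η
    have hc := isCompact_closedBall (0 : ℂ) (C * ‖ξ‖ * ‖η‖)
    obtain ⟨z, -, hz⟩ := hc.ultrafilter_le_nhds (U.map fun i => inner ℂ (T i ξ) η) (by
      refine le_principal_iff.2 ?_
      refine Filter.mem_map.2 (Filter.univ_mem' fun i => ?_)
      simpa using hb ξ η i)
    exact ⟨z, hz⟩
  choose L hL using hex
  have hLb : ∀ ξ η, ‖L ξ η‖ ≤ C * ‖ξ‖ * ‖η‖ := fun ξ η =>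
    le_of_tendsto (hL ξ η).norm (Eventually.of_forall (hb ξ η))
  -- The limits form a bounded sesquilinear form; `S` is the operator that represents it.
  let B : H →L⋆[ℂ] H →L[ℂ] ℂ := LinearMap.mkContinuous₂
    (LinearMap.mk₂'ₛₗ (starRingEnd ℂ) (RingHom.id ℂ) L
      (fun a b η => tendsto_nhds_unique (hL _ _)
        (by simpa [inner_add_left] using (hL a η).add (hL b η)))
      (fun c a η => tendsto_nhds_unique (hL _ _)
        (by simpa only [ContinuousLinearMap.map_smul, inner_smul_left, smul_eq_mul] using
          (hL a η).const_mul (starRingEnd ℂ c)))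
      (fun a η ζ => tendsto_nhds_unique (hL _ _)
        (by simpa [inner_add_right] using (hL a η).add (hL a ζ)))
      (fun c a η => tendsto_nhds_unique (hL _ _)
        (by simpa [inner_smul_right] using (hL a η).const_mul c))) C hLb
  refine ⟨InnerProductSpace.continuousLinearMapOfBilin B, ?_, fun ξ η => ?_⟩
  · refine ContinuousLinearMap.opNorm_le_bound _ hC fun ξ => ?_
    have h1 : ‖InnerProductSpace.continuousLinearMapOfBilin B ξ‖ = ‖B ξ‖ :=
      LinearIsometryEquiv.norm_map (InnerProductSpace.toDual ℂ H).symm (B ξ)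
    rw [h1]
    exact ContinuousLinearMap.opNorm_le_bound _ (by positivity) (hLb ξ)
  · rw [InnerProductSpace.continuousLinearMapOfBilin_apply]
    exact hL ξ η

/-- A net of contractions into a von Neumann algebra approximating the identity on it yields a
norm one projection. -/
theorem isAmenable_of_approx (A : VonNeumannAlgebra H)
    (h : ∀ (F : Finset (H →L[ℂ] H)) (ε : ℝ), 0 < ε → (∀ a ∈ F, a ∈ A) →
      ∃ E : (H →L[ℂ] H) →ₗ[ℂ] (H →L[ℂ] H), (∀ x, ‖E x‖ ≤ ‖x‖) ∧ (∀ x, E x ∈ A) ∧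
        ∀ a ∈ F, ‖E a - a‖ ≤ ε) : IsAmenable A := by
  classical
  have h' : ∀ i : Finset (H →L[ℂ] H) × ℕ, ∃ E : (H →L[ℂ] H) →ₗ[ℂ] (H →L[ℂ] H),
      (∀ x, ‖E x‖ ≤ ‖x‖) ∧ (∀ x, E x ∈ A) ∧
        ∀ a ∈ i.1, a ∈ A → ‖E a - a‖ ≤ 1 / ((i.2 : ℝ) + 1) := by
    intro i
    obtain ⟨E, h1, h2, h3⟩ := h (i.1.filter (· ∈ A)) (1 / ((i.2 : ℝ) + 1)) (by positivity)
      (fun a ha => (Finset.mem_filter.1 ha).2)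
    exact ⟨E, h1, h2, fun a ha haA => h3 a (Finset.mem_filter.2 ⟨ha, haA⟩)⟩
  choose E hE1 hE2 hE3 using h'
  -- Indices pair a finite set with a precision. The point-weak limit along an ultrafilter below
  -- `atTop` stays in `A`, because commuting with the commutant is a weakly closed condition.
  let U : Ultrafilter (Finset (H →L[ℂ] H) × ℕ) := Ultrafilter.of atTop
  have hU : (U : Filter (Finset (H →L[ℂ] H) × ℕ)) ≤ atTop := Ultrafilter.of_le atTop
  choose S hS1 hS2 using fun x : H →L[ℂ] H =>
    exists_weak_ultralimit U (fun i => E i x) (norm_nonneg x) (fun i => hE1 i x)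
  have huniq : ∀ (x y : H →L[ℂ] H),
      (∀ ξ η, Tendsto (fun i => inner ℂ (E i x ξ) η) U (𝓝 (inner ℂ (y ξ) η))) → S x = y := by
    intro x y hy
    ext ξ
    exact ext_inner_right ℂ fun η => tendsto_nhds_unique (hS2 x ξ η) (hy ξ η)
  refine ⟨{ toFun := S, map_add' := fun x y => huniq _ _ fun ξ η => ?_,
            map_smul' := fun c x => huniq _ _ fun ξ η => ?_ }, hS1, fun x => ?_, fun x hx => ?_⟩
  · simpa [inner_add_left] using (hS2 x ξ η).add (hS2 y ξ η)
  · simpa only [map_smul, _root_.smul_apply, inner_smul_left, smul_eq_mul,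
      RingHom.id_apply] using (hS2 x ξ η).const_mul (starRingEnd ℂ c)
  · refine mem_of_commute fun y hy => ?_
    ext ξ
    refine ext_inner_right ℂ fun η => ?_
    have h1 := hS2 x ξ (star y η)
    have h2 := hS2 x (y ξ) η
    have h3 : ∀ i, inner ℂ (E i x ξ) (star y η) = inner ℂ (E i x (y ξ)) η := by
      intro i
      rw [ContinuousLinearMap.star_eq_adjoint, ContinuousLinearMap.adjoint_inner_right]
      exact congrArg (fun t : H →L[ℂ] H => inner ℂ (t ξ) η) (commute_of_mem (hE2 i x) hy)
    simp only [h3] at h1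
    have h4 := tendsto_nhds_unique h1 h2
    rw [ContinuousLinearMap.star_eq_adjoint, ContinuousLinearMap.adjoint_inner_right] at h4
    exact h4
  · refine huniq _ _ fun ξ η => ?_
    have hlim : Tendsto (fun i : Finset (H →L[ℂ] H) × ℕ => 1 / ((i.2 : ℝ) + 1)) atTop (𝓝 0) := by
      rw [← prod_atTop_atTop_eq]
      exact tendsto_one_div_add_atTop_nhds_zero_nat.comp tendsto_snd
    have hnorm : Tendsto (fun i => E i x) atTop (𝓝 x) := by
      rw [tendsto_iff_norm_sub_tendsto_zero]
      refine squeeze_zero' (Eventually.of_forall fun _ => norm_nonneg _) ?_ hlim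
      filter_upwards [eventually_ge_atTop (({x} : Finset (H →L[ℂ] H)), 0)] with i hi
      exact hE3 i x (hi.1 (Finset.mem_singleton_self x)) hx
    have hc : Continuous fun T : H →L[ℂ] H => inner ℂ (T ξ) η := by fun_prop
    exact (hc.tendsto x).comp (hnorm.mono_left hU)

open WeakDual in
/-- Completely positive approximation of the identity of a commutative C⋆-algebra. -/
theorem exists_approx_of_commCStarAlgebra {𝒜 : Type*} [CommCStarAlgebra 𝒜] (F : Set 𝒜)
    (hF : F.Finite) {ε : ℝ} (hε : 0 < ε) :
    ∃ (t : Finset (characterSpace ℂ 𝒜)) (f : t → 𝒜),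
      (∀ (c : t → ℂ) (R : ℝ), 0 ≤ R → (∀ i, ‖c i‖ ≤ R) → ‖∑ i, c i • f i‖ ≤ R) ∧
      ∀ a ∈ F, ‖∑ i : t, i.1 a • f i - a‖ ≤ ε := by
  classical
  let X := characterSpace ℂ 𝒜
  -- On `V x` each element of `F` differs from its value at `x` by less than `ε`, so a partition of
  -- unity subordinate to finitely many `V x` approximates `F` within `ε`.
  let V : X → Set X := fun x => {y | ∀ a ∈ F, ‖x a - y a‖ < ε}
  have hev : ∀ a : 𝒜, Continuous fun y : X => y a := fun a =>
    (gelfandTransform ℂ 𝒜 a).continuous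
  have hVo : ∀ x, IsOpen (V x) := by
    intro x
    have : V x = ⋂ a ∈ F, {y : X | ‖x a - y a‖ < ε} := by ext; simp [V]
    rw [this]
    exact hF.isOpen_biInter fun a _ => isOpen_lt ((continuous_const.sub (hev a)).norm)
      continuous_const
  obtain ⟨t, ht⟩ := (isCompact_univ (X := X)).elim_finite_subcover V hVo
    (fun x _ => Set.mem_iUnion.2 ⟨x, fun a _ => by simpa using hε⟩)
  obtain ⟨ρ, hρ⟩ := PartitionOfUnity.exists_isSubordinate isClosed_univ
    (fun i : t => V i) (fun i => hVo i) (by simpa [Set.iUnion_subtype] using ht)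
  have hsum : ∀ y : X, ∑ i, ρ i y = 1 := fun y => by
    rw [← finsum_eq_sum_of_fintype]; exact ρ.sum_eq_one (Set.mem_univ y)
  let Γ := gelfandStarTransform 𝒜
  have hΓ : ∀ a, ‖a‖ = ‖Γ a‖ := fun a =>
    ((AddMonoidHomClass.isometry_iff_norm (gelfandTransform ℂ 𝒜)).1
      (gelfandTransform_isometry 𝒜) a).symm
  have hΓa : ∀ a (y : X), Γ a y = y a := fun a y => rfl
  let g : t → C(X, ℂ) := fun i => ⟨fun y => (ρ i y : ℂ), by fun_prop⟩
  refine ⟨t, fun i => Γ.symm (g i), fun c R hR hc => ?_, fun a ha => ?_⟩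
  · rw [hΓ, ContinuousMap.norm_le _ hR]
    intro y
    simp only [map_sum, map_smul, StarAlgEquiv.apply_symm_apply, ContinuousMap.coe_sum,
      Finset.sum_apply, ContinuousMap.smul_apply, smul_eq_mul]
    calc ‖∑ i, c i * g i y‖ ≤ ∑ i, R * ρ i y := by
          refine norm_sum_le_of_le _ fun i _ => ?_
          rw [norm_mul]
          have : ‖g i y‖ = ρ i y := by
            simp [g, abs_of_nonneg (ρ.nonneg i y)]
          rw [this]
          exact mul_le_mul_of_nonneg_right (hc i) (ρ.nonneg i y)
      _ = R := by rw [← Finset.mul_sum, hsum, mul_one]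
  · rw [hΓ, ContinuousMap.norm_le _ hε.le]
    intro y
    have hone : ∑ i, g i y = 1 := by
      have := hsum y
      simp only [g, ContinuousMap.coe_mk]
      exact_mod_cast this
    have : (Γ (∑ i : t, i.1 a • Γ.symm (g i) - a)) y = ∑ i : t, (i.1 a - y a) * g i y := by
      simp only [map_sub, map_sum, map_smul, StarAlgEquiv.apply_symm_apply, ContinuousMap.sub_apply,
        ContinuousMap.coe_sum, Finset.sum_apply, ContinuousMap.smul_apply, smul_eq_mul, hΓa,
        sub_mul, Finset.sum_sub_distrib, ← Finset.mul_sum, hone, mul_one]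
    rw [this]
    calc ‖∑ i : t, (i.1 a - y a) * g i y‖ ≤ ∑ i : t, ε * ρ i y := by
          refine norm_sum_le_of_le _ fun i _ => ?_
          rw [norm_mul]
          have hn : ‖g i y‖ = ρ i y := by simp [g, abs_of_nonneg (ρ.nonneg i y)]
          rw [hn]
          by_cases h0 : ρ i y = 0
          · simp [h0]
          · have : y ∈ V i := hρ i (subset_tsupport _ h0)
            exact mul_le_mul_of_nonneg_right (this a ha).le (ρ.nonneg i y)
      _ = ε := by rw [← Finset.mul_sum, hsum, mul_one]

/-- The partition-of-unity approximations factor through finitely many characters. Hahn–Banach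
extends each character to `B(H)` with norm at most one, and the resulting combination is still a
contraction. -/
theorem isAmenable_of_isAbelianVN {A : VonNeumannAlgebra H} (hA : IsAbelianVN A) :
    IsAmenable A := by
  classical
  have hc : IsClosed (A.toStarSubalgebra : Set (H →L[ℂ] H)) := isClosed_vN A
  let _ : CommCStarAlgebra A.toStarSubalgebra :=
    { (inferInstance : CStarAlgebra A.toStarSubalgebra) with
      mul_comm := fun x y => Subtype.ext (hA x x.2 y y.2) }
  refine isAmenable_of_approx A fun F ε hε hFA => ?_
  obtain ⟨t, f, hf1, hf2⟩ := exists_approx_of_commCStarAlgebra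
    ((Subtype.val : A.toStarSubalgebra → H →L[ℂ] H) ⁻¹' F)
    (F.finite_toSet.preimage Subtype.val_injective.injOn) hε
  have hext : ∀ φ : WeakDual.characterSpace ℂ A.toStarSubalgebra,
      ∃ g : StrongDual ℂ (H →L[ℂ] H), (∀ a : A.toStarSubalgebra, g a = φ a) ∧ ‖g‖ ≤ 1 := by
    intro φ
    obtain ⟨g, hg1, hg2⟩ := exists_extension_norm_eq
      (Subalgebra.toSubmodule A.toStarSubalgebra.toSubalgebra)
      ((φ : WeakDual ℂ A.toStarSubalgebra) : A.toStarSubalgebra →L[ℂ] ℂ)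
    refine ⟨g, hg1, hg2.le.trans ?_⟩
    refine ContinuousLinearMap.opNorm_le_bound _ zero_le_one fun a => ?_
    rw [one_mul]
    refine (spectrum.norm_le_norm_mul_of_mem (AlgHom.apply_mem_spectrum φ a)).trans ?_
    exact mul_le_of_le_one_right (norm_nonneg a) ContinuousLinearMap.norm_id_le
  choose g hg1 hg2 using hext
  refine ⟨∑ i : t, (g i).toLinearMap.smulRight (f i : H →L[ℂ] H), fun x => ?_, fun x => ?_,
    fun a ha => ?_⟩
  · have := hf1 (fun i => g i x) ‖x‖ (norm_nonneg x) fun i =>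
      ((g i).le_of_opNorm_le (hg2 i) x).trans (one_mul _).le
    simpa using this
  · rw [LinearMap.sum_apply]
    exact sum_mem fun i _ => smul_mem A _ (f i).2
  · have := hf2 ⟨a, hFA a ha⟩ ha
    have hcoe : ((∑ i : t, i.1 ⟨a, hFA a ha⟩ • f i : A.toStarSubalgebra) : H →L[ℂ] H) =
        ∑ i : t, g i a • (f i : H →L[ℂ] H) := by
      rw [AddSubmonoidClass.coe_finsetSum]
      exact Finset.sum_congr rfl fun i _ => by rw [hg1 i ⟨a, hFA a ha⟩]; rfl
    rw [LinearMap.sum_apply]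
    refine le_trans (le_of_eq ?_) this
    change _ = ‖((∑ i : t, i.1 ⟨a, hFA a ha⟩ • f i : A.toStarSubalgebra) : H →L[ℂ] H) - a‖
    rw [hcoe]
    rfl

/-! ### Sequences of orthogonal projections in a finite algebra -/

theorem orthogonalFamily_range {p : ℕ → H →L[ℂ] H} (hp : ∀ n, IsStarProjection (p n))
    (ho : ∀ m n, m ≠ n → p m * p n = 0) :
    OrthogonalFamily ℂ (fun n => (p n).range) fun n => (p n).range.subtypeₗᵢ := by
  rintro m n hmn ⟨_, x, rfl⟩ ⟨_, y, rfl⟩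
  change inner ℂ (p m x) (p n y) = 0
  rw [← ContinuousLinearMap.adjoint_inner_right, ← ContinuousLinearMap.star_eq_adjoint,
    (hp m).isSelfAdjoint.star_eq]
  change inner ℂ x ((p m * p n) y) = 0
  simp [ho m n hmn]

theorem summable_norm_sq_of_orthogonal {p : ℕ → H →L[ℂ] H} (hp : ∀ n, IsStarProjection (p n))
    (ho : ∀ m n, m ≠ n → p m * p n = 0) (ξ : H) : Summable fun n => ‖p n ξ‖ ^ 2 := by
  refine summable_of_sum_le (c := ‖ξ‖ ^ 2) (fun _ => sq_nonneg _) fun F => ?_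
  have h1 : ‖∑ i ∈ F, p i ξ‖ ^ 2 = ∑ i ∈ F, ‖p i ξ‖ ^ 2 :=
    (orthogonalFamily_range hp ho).norm_sum (fun n => ⟨p n ξ, ⟨ξ, rfl⟩⟩) F
  have h2 : (∑ i ∈ F, ‖p i ξ‖ ^ 2 : ℝ) = RCLike.re (inner ℂ ξ (∑ i ∈ F, p i ξ)) := by
    rw [inner_sum, map_sum]
    refine Finset.sum_congr rfl fun i _ => ?_
    have : p i ξ = p i (p i ξ) :=
      (congrArg (fun t : H →L[ℂ] H => t ξ) (hp i).isIdempotentElem).symm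
    rw [this, ← ContinuousLinearMap.adjoint_inner_left, ← ContinuousLinearMap.star_eq_adjoint,
      (hp i).isSelfAdjoint.star_eq, ← this, inner_self_eq_norm_sq]
  have h3 := (RCLike.re_le_norm _).trans (norm_inner_le_norm (𝕜 := ℂ) ξ (∑ i ∈ F, p i ξ))
  rw [← h2, ← h1] at h3
  rw [← h1]
  nlinarith [norm_nonneg ξ, norm_nonneg (∑ i ∈ F, p i ξ)]

theorem summable_of_orthogonal {p : ℕ → H →L[ℂ] H} (hp : ∀ n, IsStarProjection (p n))
    (ho : ∀ m n, m ≠ n → p m * p n = 0) {y : ℕ → H} (hy : ∀ n, p n (y n) = y n)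
    (hs : Summable fun n => ‖y n‖ ^ 2) : Summable y :=
  ((orthogonalFamily_range hp ho).summable_iff_norm_sq_summable
    (fun n => ⟨y n, ⟨y n, hy n⟩⟩)).2 hs

/-- A finite von Neumann algebra has no infinite sequence of successively equivalent, pairwise
orthogonal nonzero projections. -/
theorem IsFiniteVN.eq_zero_of_shift {M : VonNeumannAlgebra H} (hM : IsFiniteVN M)
    {p w : ℕ → H →L[ℂ] H} (hp : ∀ n, IsStarProjection (p n)) (hpM : ∀ n, p n ∈ M)
    (ho : ∀ m n, m ≠ n → p m * p n = 0) (hw : ∀ n, w n ∈ M) (hsw : ∀ n, star (w n) * w n = p n)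
    (hpw : ∀ n, p (n + 1) * w n = w n) : p 0 = 0 := by
  have hi : ∀ n, p n * p n = p n := fun n => (hp n).isIdempotentElem
  have hs : ∀ n, star (p n) = p n := fun n => (hp n).isSelfAdjoint.star_eq
  -- `t n = 1 - ∑_{k ≤ n} p k + ∑_{k < n} w k`, with `t n* t n = 1 - p n`. Its strong limit is an
  -- isometry because `p n ξ → 0`, yet `p 0` annihilates its range.
  let t : ℕ → H →L[ℂ] H := fun n => n.rec (1 - p 0) fun k s => s - p (k + 1) + w k
  have ht0 : t 0 = 1 - p 0 := rfl
  have hts : ∀ n, t (n + 1) = t n - p (n + 1) + w n := fun n => rfl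
  have hpm : ∀ m n, m ≠ n + 1 → p m * w n = 0 := fun m n h => by
    rw [← hpw n, ← mul_assoc, ho _ _ h, zero_mul]
  have hb : ∀ n m, n < m → p m * t n = p m := by
    intro n
    induction n with
    | zero => intro m hm; rw [ht0, mul_sub, mul_one, ho _ _ hm.ne', sub_zero]
    | succ k ih =>
      intro m hm
      rw [hts, mul_add, mul_sub, ih m (by omega), ho _ _ hm.ne', hpm _ _ hm.ne', sub_zero, add_zero]
  have hc : ∀ n, p 0 * t n = 0 := by
    intro n
    induction n with
    | zero => rw [ht0, mul_sub, mul_one, hi, sub_self]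
    | succ k ih =>
      rw [hts, mul_add, mul_sub, ih, ho _ _ (by omega), hpm _ _ (by omega), sub_zero, add_zero]
  have ha : ∀ n, star (t n) * t n = 1 - p n := by
    intro n
    induction n with
    | zero =>
      rw [ht0, star_sub, star_one, hs, sub_mul, one_mul, mul_sub, mul_one, hi, sub_self, sub_zero]
    | succ k ih =>
      have e1 : star (t k) * p (k + 1) = p (k + 1) := by
        have := congrArg star (hb k (k + 1) (by omega))
        simpa [hs] using this
      have e2 : star (t k) * w k = w k := by
        rw [← hpw k, ← mul_assoc, e1]
      have e3 : star (w k) * p (k + 1) = star (w k) := by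
        simpa [hs] using congrArg star (hpw k)
      have e4 : star (w k) * t k = star (w k) := by
        simpa using congrArg star e2
      rw [hts, star_add, star_sub, hs]
      simp only [add_mul, sub_mul, mul_add, mul_sub, ih, e1, e2, e3, e4, hb k (k + 1) (by omega),
        hi, hpw, hsw]
      abel
  have htM : ∀ n, t n ∈ M := by
    intro n
    induction n with
    | zero => exact sub_mem (one_mem M) (hpM 0)
    | succ k ih => exact add_mem (sub_mem ih (hpM _)) (hw _)
  have hnw : ∀ n ξ, ‖w n ξ‖ = ‖p n ξ‖ := by
    intro n ξ
    have h1 : ∀ T : H →L[ℂ] H, ‖T ξ‖ ^ 2 = RCLike.re (inner ℂ ((star T * T) ξ) ξ) := by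
      intro T
      rw [ContinuousLinearMap.star_eq_adjoint, mul_apply_eq_comp,
        ContinuousLinearMap.adjoint_inner_left, inner_self_eq_norm_sq]
    have := h1 (w n)
    rw [hsw] at this
    have h2 := h1 (p n)
    rw [hs, hi] at h2
    exact (sq_eq_sq₀ (norm_nonneg _) (norm_nonneg _)).1 (this.trans h2.symm)
  have hsum : ∀ ξ, Summable fun n => w n ξ - p (n + 1) ξ := by
    intro ξ
    have hp' : ∀ n, IsStarProjection (p (n + 1)) := fun n => hp _
    have ho' : ∀ m n, m ≠ n → p (m + 1) * p (n + 1) = 0 := fun m n h => ho _ _ (by omega)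
    refine (summable_of_orthogonal hp' ho' (y := fun n => w n ξ) (fun n => ?_) ?_).sub
      (summable_of_orthogonal hp' ho' (y := fun n => p (n + 1) ξ) (fun n => ?_) ?_)
    · exact congrArg (fun t : H →L[ℂ] H => t ξ) (hpw n)
    · simpa only [hnw] using summable_norm_sq_of_orthogonal hp ho ξ
    · exact congrArg (fun t : H →L[ℂ] H => t ξ) (hi (n + 1))
    · exact summable_norm_sq_of_orthogonal hp' ho' ξ
  have htsum : ∀ n ξ, t n ξ = (ξ - p 0 ξ) + ∑ k ∈ Finset.range n, (w k ξ - p (k + 1) ξ) := by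
    intro n ξ
    induction n with
    | zero => simp [ht0]
    | succ k ih =>
      rw [Finset.sum_range_succ, ← add_assoc, ← ih, hts]
      change t k ξ - p (k + 1) ξ + w k ξ = _
      abel
  have htend : ∀ ξ, Tendsto (fun n => t n ξ) atTop
      (𝓝 ((ξ - p 0 ξ) + ∑' k, (w k ξ - p (k + 1) ξ))) := by
    intro ξ
    simp only [htsum]
    exact (hsum ξ).hasSum.tendsto_sum_nat.const_add _
  let v : H →L[ℂ] H := continuousLinearMapOfTendsto t (tendsto_pi_nhds.2 htend)
  have hv : ∀ ξ, Tendsto (fun n => t n ξ) atTop (𝓝 (v ξ)) := htend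
  have hvM : v ∈ M := by
    refine mem_of_commute fun y hy => ?_
    ext ξ
    refine tendsto_nhds_unique ((y.continuous.tendsto _).comp (hv ξ)) ?_
    refine (hv (y ξ)).congr fun n => ?_
    exact (congrArg (fun t : H →L[ℂ] H => t ξ) (commute_of_mem (htM n) hy)).symm
  have hiso : star v * v = 1 := by
    refine (ContinuousLinearMap.norm_map_iff_adjoint_comp_self v).1 fun ξ => ?_
    have h1 : ∀ n, ‖t n ξ‖ ^ 2 = ‖ξ‖ ^ 2 - ‖p n ξ‖ ^ 2 := by
      intro n
      have e1 : ‖t n ξ‖ ^ 2 = RCLike.re (inner ℂ ((star (t n) * t n) ξ) ξ) := by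
        rw [ContinuousLinearMap.star_eq_adjoint, mul_apply_eq_comp,
          ContinuousLinearMap.adjoint_inner_left, inner_self_eq_norm_sq]
      have e2 : ‖p n ξ‖ ^ 2 = RCLike.re (inner ℂ ((star (p n) * p n) ξ) ξ) := by
        rw [ContinuousLinearMap.star_eq_adjoint, mul_apply_eq_comp,
          ContinuousLinearMap.adjoint_inner_left, inner_self_eq_norm_sq]
      rw [e1, e2, ha, hs, hi]
      simp [inner_self_eq_norm_sq_to_K, ← Complex.ofReal_pow]
    have h2 : Tendsto (fun n => ‖t n ξ‖ ^ 2) atTop (𝓝 (‖v ξ‖ ^ 2)) := (hv ξ).norm.pow 2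
    have h3 : Tendsto (fun n => ‖t n ξ‖ ^ 2) atTop (𝓝 (‖ξ‖ ^ 2 - 0)) := by
      simp only [h1]
      exact (summable_norm_sq_of_orthogonal hp ho ξ).tendsto_atTop_zero.const_sub _
    have h4 := tendsto_nhds_unique h2 h3
    rw [sub_zero] at h4
    exact (sq_eq_sq₀ (norm_nonneg _) (norm_nonneg _)).1 h4
  have hpv : p 0 * v = 0 := by
    ext ξ
    refine tendsto_nhds_unique (((p 0).continuous.tendsto _).comp (hv ξ)) ?_
    refine tendsto_const_nhds.congr fun n => ?_
    exact (congrArg (fun t : H →L[ℂ] H => t ξ) (hc n)).symm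
  calc p 0 = p 0 * (v * star v) := by rw [hM v hvM hiso, mul_one]
    _ = 0 := by rw [← mul_assoc, hpv, zero_mul]

/-! ### Minimal projections of abelian algebras and their orbits -/

/-- The support projection of `b * q` lies under `q`, so it is `0` or `q`. Since `c` kills this
support, in the second case it kills `q`. -/
theorem IsMinimalProjection.eq_zero_or {A : VonNeumannAlgebra H} (hA : IsAbelianVN A)
    {q : H →L[ℂ] H} (hq : IsMinimalProjection A q) {b c : H →L[ℂ] H} (hb : b ∈ A)
    (h : c * b = 0) : b * q = 0 ∨ c * q = 0 := by
  obtain ⟨hqA, hqp, -, hmin⟩ := hq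
  have hqi : q * q = q := hqp.isIdempotentElem
  obtain ⟨R, hRA, hRp, hR1, hR2⟩ := exists_supportProjection A (S := {b * q})
    (by simpa using mul_mem hb hqA)
  have h1 : (1 - q) * R = 0 := hR2 _ fun x hx => by
    rw [Set.mem_singleton_iff.1 hx, hA b hb q hqA, ← mul_assoc, sub_mul, one_mul, hqi, sub_self,
      zero_mul]
  have h2 : c * R = 0 := hR2 _ fun x hx => by
    rw [Set.mem_singleton_iff.1 hx, ← mul_assoc, h, zero_mul]
  have h3 : R * q = R := by
    rw [hA R hRA q hqA]
    rw [sub_mul, one_mul, sub_eq_zero] at h1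
    exact h1.symm
  rcases hmin R hRA hRp h3 with h0 | h0
  · left
    rw [← hR1 _ rfl, h0, zero_mul]
  · right
    rw [← h0]; exact h2

/-- Connectedness of `ℝ` finds the scalar. The parts `(a - l)₊` and `(l - a)₊` have product zero, so
for each `l` one of them vanishes on `q`. The two closed sets of such `l` cover `ℝ` and are
nonempty, as `±‖a‖` shows; at a common `l`, `(a - l) q = 0`. -/
theorem IsMinimalProjection.exists_mul_eq_smul_of_isSelfAdjoint {A : VonNeumannAlgebra H}
    (hA : IsAbelianVN A) {q : H →L[ℂ] H} (hq : IsMinimalProjection A q) {a : H →L[ℂ] H}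
    (ha : a ∈ A) (hsa : IsSelfAdjoint a) : ∃ c : ℂ, a * q = c • q := by
  let f : ℝ → H →L[ℂ] H := fun l => cfc (fun t : ℝ => max (t - l) 0) a
  let g : ℝ → H →L[ℂ] H := fun l => cfc (fun t : ℝ => max (l - t) 0) a
  have hmax : ∀ x y : ℝ, |max x 0 - max y 0| ≤ |x - y| := fun x y =>
    abs_max_sub_max_le_abs x y 0
  have hf : Continuous f := by
    refine (LipschitzWith.of_dist_le_mul (K := 1) fun l m => ?_).continuous
    rw [dist_eq_norm, dist_eq_norm, ← cfc_sub _ _ a, NNReal.coe_one, one_mul]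
    refine norm_cfc_le (norm_nonneg _) fun x _ => ?_
    refine (hmax _ _).trans (le_of_eq ?_)
    rw [sub_sub_sub_cancel_left, ← norm_sub_rev, Real.norm_eq_abs]
  have hg : Continuous g := by
    refine (LipschitzWith.of_dist_le_mul (K := 1) fun l m => ?_).continuous
    rw [dist_eq_norm, dist_eq_norm, ← cfc_sub _ _ a, NNReal.coe_one, one_mul]
    refine norm_cfc_le (norm_nonneg _) fun x _ => ?_
    refine (hmax _ _).trans (le_of_eq ?_)
    rw [sub_sub_sub_cancel_right, Real.norm_eq_abs]
  have hfg : ∀ l, f l * g l = 0 := by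
    intro l
    rw [← cfc_mul _ _ a]
    convert cfc_zero ℝ a using 2
    ext t
    rcases le_total t l with h | h
    · simp [max_eq_right (sub_nonpos.2 h)]
    · simp [max_eq_right (sub_nonpos.2 h)]
  have hspec : ∀ t ∈ spectrum ℝ a, |t| ≤ ‖a‖ := fun t ht => by
    refine (spectrum.norm_le_norm_mul_of_mem ht).trans ?_
    exact mul_le_of_le_one_right (norm_nonneg a) ContinuousLinearMap.norm_id_le
  have hpre := isPreconnected_closed_iff.1 (isPreconnected_univ (α := ℝ)) {l | f l * q = 0}
    {l | g l * q = 0} (isClosed_eq (hf.mul continuous_const) continuous_const)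
    (isClosed_eq (hg.mul continuous_const) continuous_const)
    (fun l _ => hq.eq_zero_or hA (cfc_mem_vN A _ ha)
      (by rw [hA _ (cfc_mem_vN A _ ha) _ (cfc_mem_vN A _ ha)]; exact hfg l))
    ⟨‖a‖, trivial, by
      have : f ‖a‖ = 0 := by
        rw [← cfc_zero ℝ a]
        refine cfc_congr fun t ht => ?_
        exact max_eq_right (sub_nonpos.2 ((le_abs_self t).trans (hspec t ht)))
      simp [this]⟩
    ⟨-‖a‖, trivial, by
      have : g (-‖a‖) = 0 := by
        rw [← cfc_zero ℝ a]
        refine cfc_congr fun t ht => ?_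
        exact max_eq_right (by linarith [neg_abs_le t, hspec t ht])
      simp [this]⟩
  obtain ⟨l, -, h1, h2⟩ := hpre
  refine ⟨l, ?_⟩
  have h3 : f l - g l = a - algebraMap ℝ _ l := by
    rw [← cfc_sub _ _ a]
    have : (fun t : ℝ => max (t - l) 0 - max (l - t) 0) = fun t => t - l := by
      ext t
      rcases le_total t l with h | h
      · rw [max_eq_right (sub_nonpos.2 h), max_eq_left (sub_nonneg.2 h)]; ring
      · rw [max_eq_left (sub_nonneg.2 h), max_eq_right (sub_nonpos.2 h)]; ring
    rw [this, cfc_sub _ _ a, cfc_id' ℝ a, cfc_const l a]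
  have h4 : (f l - g l) * q = 0 := by
    rw [sub_mul, h1, h2, sub_zero]
  rw [h3, sub_mul, sub_eq_zero] at h4
  rw [h4, Algebra.algebraMap_eq_smul_one, smul_mul_assoc, one_mul]
  rfl

theorem IsMinimalProjection.exists_mul_eq_smul {A : VonNeumannAlgebra H}
    (hA : IsAbelianVN A) {q : H →L[ℂ] H} (hq : IsMinimalProjection A q) {a : H →L[ℂ] H}
    (ha : a ∈ A) : ∃ c : ℂ, a * q = c • q := by
  have h1 : a + star a ∈ A := add_mem ha (star_mem ha)
  have h2 : Complex.I • (a - star a) ∈ A := smul_mem A _ (sub_mem ha (star_mem ha))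
  obtain ⟨c, hc⟩ := hq.exists_mul_eq_smul_of_isSelfAdjoint hA h1
    (by simp [IsSelfAdjoint, add_comm])
  obtain ⟨d, hd⟩ := hq.exists_mul_eq_smul_of_isSelfAdjoint hA h2
    (by rw [IsSelfAdjoint, star_smul, star_sub, star_star]; simp [← smul_neg])
  refine ⟨(1 / 2) * (c - Complex.I * d), ?_⟩
  have h3 : a = (1 / 2 : ℂ) • ((a + star a) - Complex.I • (Complex.I • (a - star a))) := by
    rw [smul_smul, Complex.I_mul_I, neg_one_smul, sub_neg_eq_add, add_add_sub_cancel, ← two_smul ℂ,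
      smul_smul]
    norm_num
  rw [h3, smul_mul_assoc, sub_mul, smul_mul_assoc, hc, hd, smul_smul, ← sub_smul, smul_smul]

theorem IsMinimalProjection.mul_eq_zero {A : VonNeumannAlgebra H} (hA : IsAbelianVN A)
    {p q : H →L[ℂ] H} (hp : IsMinimalProjection A p) (hq : IsMinimalProjection A q)
    (hpq : p ≠ q) : p * q = 0 := by
  have hc : p * q = q * p := hA p hp.1 q hq.1
  have hpi : p * p = p := hp.2.1.isIdempotentElem
  have hqi : q * q = q := hq.2.1.isIdempotentElem
  have hproj : IsStarProjection (p * q) := by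
    refine ⟨?_, ?_⟩
    · change p * q * (p * q) = p * q
      rw [mul_assoc, ← mul_assoc q, ← hc, mul_assoc p q q, hqi, ← mul_assoc, hpi]
    · rw [IsSelfAdjoint, star_mul, hp.2.1.isSelfAdjoint.star_eq, hq.2.1.isSelfAdjoint.star_eq, hc]
  rcases hp.2.2.2 (p * q) (mul_mem hp.1 hq.1) hproj (by rw [hc, mul_assoc, hpi]) with h | h
  · exact h
  rcases hq.2.2.2 (p * q) (mul_mem hp.1 hq.1) hproj (by rw [mul_assoc, hqi]) with h' | h'
  · exact h'
  · exact absurd (h.symm.trans h') hpq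

theorem isStarProjection_conj {p u : H →L[ℂ] H} (hp : IsStarProjection p) (hu : star u * u = 1) :
    IsStarProjection (u * p * star u) := by
  refine ⟨?_, ?_⟩
  · change u * p * star u * (u * p * star u) = u * p * star u
    calc u * p * star u * (u * p * star u) = u * p * (star u * u) * p * star u := by
          simp only [mul_assoc]
      _ = u * (p * p) * star u := by rw [hu, mul_one, mul_assoc u p p]
      _ = _ := by rw [hp.isIdempotentElem]
  · rw [IsSelfAdjoint, star_mul, star_mul, star_star, hp.isSelfAdjoint.star_eq, mul_assoc]

theorem IsMinimalProjection.conj {M A : VonNeumannAlgebra H} {p u : H →L[ℂ] H}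
    (hp : IsMinimalProjection A p) (hu : u ∈ unitaryNormalizer M (A : Set (H →L[ℂ] H))) :
    IsMinimalProjection A (u * p * star u) := by
  obtain ⟨-, h1, h2, h3, h4⟩ := mem_unitaryNormalizer_iff.1 hu
  have hinv : ∀ r : H →L[ℂ] H, u * (star u * r * u) * star u = r := fun r => by
    calc u * (star u * r * u) * star u = (u * star u) * r * (u * star u) := by
          simp only [mul_assoc]
      _ = r := by rw [h2, one_mul, mul_one]
  have hinv' : ∀ r : H →L[ℂ] H, star u * (u * r * star u) * u = r := fun r => by
    calc star u * (u * r * star u) * u = (star u * u) * r * (star u * u) := by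
          simp only [mul_assoc]
      _ = r := by rw [h1, one_mul, mul_one]
  refine ⟨h3 p hp.1, isStarProjection_conj hp.2.1 h1, fun h0 => hp.2.2.1 ?_, fun r hr hrp hrle => ?_⟩
  · rw [← hinv' p, h0, mul_zero, zero_mul]
  · have hr' : IsStarProjection (star u * r * u) := by
      simpa using isStarProjection_conj hrp (u := star u) (by simpa using h2)
    have hle : star u * r * u * p = star u * r * u := by
      calc star u * r * u * p = star u * r * u * p * (star u * u) := by rw [h1, mul_one]
        _ = star u * (r * (u * p * star u)) * u := by simp only [mul_assoc]
        _ = _ := by rw [hrle]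
    rcases hp.2.2.2 _ (h4 r hr) hr' hle with h | h
    · left; rw [← hinv r, h, mul_zero, zero_mul]
    · right; rw [← hinv r, h]

/-- A regular abelian von Neumann subalgebra of a finite factor that has a minimal projection is
finite dimensional. -/
theorem exists_finiteDimensional_of_isMinimalProjection {M A : VonNeumannAlgebra H}
    (hMf : IsFactor M) (hMfin : IsFiniteVN M) (hAM : A ≤ M) (hA : IsAbelianVN A)
    (hreg : generatedVN (unitaryNormalizer M (A : Set (H →L[ℂ] H))) = M) {p : H →L[ℂ] H}
    (hp : IsMinimalProjection A p) :
    ∃ V : Submodule ℂ (H →L[ℂ] H), FiniteDimensional ℂ V ∧ (A : Set (H →L[ℂ] H)) ⊆ V := by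
  classical
  let N := unitaryNormalizer M (A : Set (H →L[ℂ] H))
  let O : Set (H →L[ℂ] H) := {q | ∃ u ∈ N, q = u * p * star u}
  have hOmin : ∀ q ∈ O, IsMinimalProjection A q := by
    rintro _ ⟨u, hu, rfl⟩; exact hp.conj hu
  have hpi : p * p = p := hp.2.1.isIdempotentElem
  have hps : star p = p := hp.2.1.isSelfAdjoint.star_eq
  have hOfin : O.Finite := by
    by_contra hinf
    let e := Set.Infinite.natEmbedding O hinf
    choose u hu heq using fun n => (e n).2
    have hmin : ∀ n, IsMinimalProjection A (e n : H →L[ℂ] H) := fun n => hOmin _ (e n).2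
    have hu1 : ∀ n, star (u n) * u n = 1 := fun n => (mem_unitaryNormalizer_iff.1 (hu n)).2.1
    have huM : ∀ n, u n ∈ M := fun n => (mem_unitaryNormalizer_iff.1 (hu n)).1
    -- Consecutive members of an infinite orbit are linked by the partial isometries `u (n + 1) * p
    -- * star (u n)`.
    refine (hmin 0).2.2.1 (hMfin.eq_zero_of_shift (p := fun n => (e n : H →L[ℂ] H))
      (w := fun n => u (n + 1) * p * star (u n)) (fun n => (hmin n).2.1)
      (fun n => hAM (hmin n).1) (fun m n hmn => ?_) (fun n => ?_) (fun n => ?_) (fun n => ?_))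
    · exact (hmin m).mul_eq_zero hA (hmin n) fun h => hmn (e.injective (Subtype.ext h))
    · exact mul_mem (mul_mem (huM _) (hAM hp.1)) (star_mem (huM _))
    · rw [heq n, star_mul, star_mul, star_star, hps]
      calc u n * (p * star (u (n + 1))) * (u (n + 1) * p * star (u n))
          = u n * p * (star (u (n + 1)) * u (n + 1)) * p * star (u n) := by simp only [mul_assoc]
        _ = u n * (p * p) * star (u n) := by rw [hu1, mul_one, mul_assoc (u n) p p]
        _ = _ := by rw [hpi]
    · rw [heq (n + 1)]
      calc u (n + 1) * p * star (u (n + 1)) * (u (n + 1) * p * star (u n))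
          = u (n + 1) * p * (star (u (n + 1)) * u (n + 1)) * p * star (u n) := by
            simp only [mul_assoc]
        _ = u (n + 1) * (p * p) * star (u n) := by rw [hu1, mul_one, mul_assoc (u (n + 1)) p p]
        _ = _ := by rw [hpi]
  let F := hOfin.toFinset
  have hF : ∀ q, q ∈ F ↔ q ∈ O := fun q => hOfin.mem_toFinset
  let z : H →L[ℂ] H := ∑ q ∈ F, q
  have hzA : z ∈ A := sum_mem fun q hq => (hOmin q ((hF q).1 hq)).1
  have hOconj : ∀ u ∈ N, ∀ q ∈ O, u * q * star u ∈ O := by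
    rintro u hu _ ⟨v, hv, rfl⟩
    exact ⟨u * v, mul_mem_unitaryNormalizer hu hv, by simp only [star_mul, mul_assoc]⟩
  -- Conjugation by a normalizing unitary permutes the orbit and so fixes its sum.
  have hzconj : ∀ u ∈ N, u * z = z * u := by
    intro u hu
    obtain ⟨-, h1, h2, -, -⟩ := mem_unitaryNormalizer_iff.1 hu
    have hz : u * z * star u = z := by
      simp only [z, Finset.mul_sum, Finset.sum_mul]
      refine Finset.sum_bij' (fun q _ => u * q * star u) (fun q _ => star u * q * u)
        (fun q hq => (hF _).2 (hOconj u hu q ((hF q).1 hq)))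
        (fun q hq => (hF _).2 (by
          simpa using hOconj _ (star_mem_unitaryNormalizer hu) q ((hF q).1 hq)))
        (fun q _ => ?_) (fun q _ => ?_) (fun q _ => rfl)
      · calc star u * (u * q * star u) * u = (star u * u) * q * (star u * u) := by
              simp only [mul_assoc]
          _ = q := by rw [h1, one_mul, mul_one]
      · calc u * (star u * q * u) * star u = (u * star u) * q * (u * star u) := by
              simp only [mul_assoc]
          _ = q := by rw [h2, one_mul, mul_one]
    calc u * z = u * z * (star u * u) := by rw [h1, mul_one]
      _ = u * z * star u * u := by simp only [mul_assoc]
      _ = z * u := by rw [hz]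
  have hzc : z ∈ M.commutant := by
    rw [← hreg]
    exact mem_commutant_generatedVN fun u hu =>
      ⟨hzconj u hu, hzconj _ (star_mem_unitaryNormalizer hu)⟩
  obtain ⟨c, hc⟩ := hMf.2 z (hAM hzA) hzc
  have hpO : p ∈ O := ⟨1, mem_unitaryNormalizer_iff.2 (by simp [one_mem M]), by simp⟩
  have hzp : z * p = p := by
    simp only [z, Finset.sum_mul]
    rw [Finset.sum_eq_single p (fun q hq hqp => (hOmin q ((hF q).1 hq)).mul_eq_zero hA hp hqp)
      (fun h => absurd ((hF p).2 hpO) h), hpi]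
  have hz1 : z = 1 := by
    have : (c - 1) • p = 0 := by
      rw [sub_smul, one_smul, sub_eq_zero]
      rwa [hc, smul_mul_assoc, one_mul] at hzp
    rcases smul_eq_zero.1 this with h | h
    · rw [hc, sub_eq_zero.1 h, one_smul]
    · exact absurd h hp.2.2.1
  refine ⟨Submodule.span ℂ O, FiniteDimensional.span_of_finite ℂ hOfin, fun a ha => ?_⟩
  have : a = ∑ q ∈ F, a * q := by
    rw [← Finset.mul_sum]; exact (by rw [hz1, mul_one] : a = a * z)
  rw [this]
  refine Submodule.sum_mem _ fun q hq => ?_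
  obtain ⟨d, hd⟩ := (hOmin q ((hF q).1 hq)).exists_mul_eq_smul hA ha
  rw [hd]
  exact Submodule.smul_mem _ _ (Submodule.subset_span ((hF q).1 hq))

/-! ### From normalizing elements to normalizing unitaries -/

/-- A unital C*-algebra is spanned by its unitaries, and every unitary of `A` normalizes `A`. -/
theorem le_generatedVN_unitaryNormalizer {M A : VonNeumannAlgebra H} (hAM : A ≤ M) :
    A ≤ generatedVN (unitaryNormalizer M (A : Set (H →L[ℂ] H))) := by
  have hc : IsClosed (A.toStarSubalgebra : Set (H →L[ℂ] H)) := isClosed_vN A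
  intro a ha
  have h1 : (⟨a, ha⟩ : A.toStarSubalgebra) ∈
      Submodule.span ℂ (unitary A.toStarSubalgebra : Set A.toStarSubalgebra) := by
    rw [CStarAlgebra.span_unitary]; trivial
  let W := generatedVN (unitaryNormalizer M (A : Set (H →L[ℂ] H)))
  have h2 : Submodule.span ℂ (unitary A.toStarSubalgebra : Set A.toStarSubalgebra) ≤
      (Subalgebra.toSubmodule W.toStarSubalgebra.toSubalgebra).comap
        (Subalgebra.toSubmodule A.toStarSubalgebra.toSubalgebra).subtype := by
    refine Submodule.span_le.2 fun u hu => ?_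
    have hu1 : star (u : H →L[ℂ] H) * u = 1 := congrArg Subtype.val (Unitary.mem_iff.1 hu).1
    have hu2 : (u : H →L[ℂ] H) * star (u : H →L[ℂ] H) = 1 :=
      congrArg Subtype.val (Unitary.mem_iff.1 hu).2
    have huA : (u : H →L[ℂ] H) ∈ A := u.2
    exact subset_generatedVN _ (mem_unitaryNormalizer_iff.2 ⟨hAM huA, hu1, hu2,
      fun b hb => mul_mem (mul_mem huA hb) (star_mem huA),
      fun b hb => mul_mem (mul_mem (star_mem huA) hb) huA⟩)
  exact h2 h1

section PartialIsometry

variable {M A : VonNeumannAlgebra H} {v x : H →L[ℂ] H}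

/-- A partial isometry with orthogonal supports extends to a normalizing unitary. -/
theorem commutator_mul_eq_zero_of_orthogonal (hAM : A ≤ M) (hA : IsAbelianVN A) (hv : v ∈ M)
    (hvA : ∀ a ∈ A, v * a * star v ∈ A) (hvA' : ∀ a ∈ A, star v * a * v ∈ A)
    (hx : ∀ u ∈ unitaryNormalizer M (A : Set (H →L[ℂ] H)), u * x = x * u)
    (hxA : ∀ a ∈ A, a * x = x * a) {r : H →L[ℂ] H} (hr : r ∈ A) (hrp : IsStarProjection r)
    (hrv : star v * v * r = r) (ho : v * r * star v * r = 0) : (v * x - x * v) * r = 0 := by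
  have hrr : r * r = r := hrp.isIdempotentElem
  have hrs : star r = r := hrp.isSelfAdjoint.star_eq
  have hrv' : r * star v * v = r := by simpa [hrs, mul_assoc] using congrArg star hrv
  have h1 : r * star v * r = 0 := by
    calc r * star v * r = star v * v * r * star v * r := by rw [hrv]
      _ = star v * (v * r * star v * r) := by simp only [mul_assoc]
      _ = 0 := by rw [ho, mul_zero]
  have h2 : r * v * r = 0 := by simpa [hrs, mul_assoc] using congrArg star h1
  obtain ⟨s, hs⟩ : ∃ s, s = v * r := ⟨_, rfl⟩
  obtain ⟨t, ht⟩ : ∃ t, t = r * star v := ⟨_, rfl⟩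
  obtain ⟨q, hq⟩ : ∃ q, q = v * r * star v := ⟨_, rfl⟩
  have hst : star s = t := by rw [hs, ht, star_mul, hrs]
  have hts : star t = s := by rw [← hst, star_star]
  have hqA : q ∈ A := hq ▸ hvA r hr
  have hqs : star q = q := by rw [hq, star_mul, star_mul, star_star, hrs, mul_assoc]
  have sr : s * r = s := by rw [hs, mul_assoc, hrr]
  have rs : r * s = 0 := by rw [hs, ← mul_assoc, h2]
  have qs : q * s = s := by
    rw [hq, hs]
    calc v * r * star v * (v * r) = v * (r * star v * v) * r := by simp only [mul_assoc]
      _ = _ := by rw [hrv', mul_assoc, hrr]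
  have ss : s * s = 0 := by
    rw [hs]
    calc v * r * (v * r) = v * (r * v * r) := by simp only [mul_assoc]
      _ = 0 := by rw [h2, mul_zero]
  have stt : s * t = q := by
    rw [hs, ht, hq, ← mul_assoc, mul_assoc v r r, hrr]
  have tss : t * s = r := by
    rw [hs, ht, ← mul_assoc, hrv', hrr]
  have sq : s * q = 0 := by rw [← stt, ← mul_assoc, ss, zero_mul]
  have rq : r * q = 0 := by rw [← stt, ← mul_assoc, rs, zero_mul]
  have qr : q * r = 0 := by rw [hq, ho]
  have qq : q * q = q := by
    nth_rewrite 2 [← stt]; rw [← mul_assoc, qs, stt]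
  have rt : r * t = t := by rw [ht, ← mul_assoc, hrr]
  have tr : t * r = 0 := by rw [ht, h1]
  have tq : t * q = t := by simpa [hst, hqs] using congrArg star qs
  have tt : t * t = 0 := by simpa [hst] using congrArg star ss
  have qt : q * t = 0 := by simpa [hst, hqs] using congrArg star sq
  obtain ⟨f, hf⟩ : ∃ f, f = 1 - r - q := ⟨_, rfl⟩
  have hfA : f ∈ A := hf ▸ sub_mem (sub_mem (one_mem A) hr) hqA
  have sf : s * f = 0 := by rw [hf, mul_sub, mul_sub, mul_one, sr, sq, sub_self, sub_zero]
  have tf : t * f = 0 := by rw [hf, mul_sub, mul_sub, mul_one, tr, tq, sub_zero, sub_self]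
  have fs : f * s = 0 := by rw [hf, sub_mul, sub_mul, one_mul, rs, qs, sub_zero, sub_self]
  have ft : f * t = 0 := by rw [hf, sub_mul, sub_mul, one_mul, rt, qt, sub_self, sub_zero]
  have ff : f * f = f := by
    rw [hf]
    simp only [mul_sub, sub_mul, mul_one, one_mul, hrr, qq, rq, qr]
    abel
  have hfs : star f = f := by rw [hf]; simp [hrs, hqs]
  have sas : ∀ a ∈ A, s * a * s = 0 := fun a ha => by
    calc s * a * s = s * (r * a) * s := by rw [← mul_assoc s, sr]
      _ = s * a * (r * s) := by rw [hA r hr a ha]; simp only [mul_assoc]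
      _ = 0 := by rw [rs, mul_zero]
  have tat : ∀ a ∈ A, t * a * t = 0 := fun a ha => by
    have := congrArg star (sas (star a) (star_mem ha))
    simpa [hst, mul_assoc] using this
  have saf : ∀ a ∈ A, s * a * f = 0 := fun a ha => by
    rw [mul_assoc, hA a ha f hfA, ← mul_assoc, sf, zero_mul]
  have taf : ∀ a ∈ A, t * a * f = 0 := fun a ha => by
    rw [mul_assoc, hA a ha f hfA, ← mul_assoc, tf, zero_mul]
  have fas : ∀ a ∈ A, f * a * s = 0 := fun a ha => by
    rw [hA f hfA a ha, mul_assoc, fs, mul_zero]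
  have fat : ∀ a ∈ A, f * a * t = 0 := fun a ha => by
    rw [hA f hfA a ha, mul_assoc, ft, mul_zero]
  have sat : ∀ a ∈ A, s * a * t ∈ A := fun a ha => by
    have := hvA (r * a * r) (mul_mem (mul_mem hr ha) hr)
    rw [hs, ht]; simpa only [mul_assoc] using this
  have tas : ∀ a ∈ A, t * a * s ∈ A := fun a ha => by
    have := mul_mem (mul_mem hr (hvA' a ha)) hr
    rw [hs, ht]; simpa only [mul_assoc] using this
  -- This self-adjoint unitary exchanges `r` with the orthogonal projection `q` and is the identity
  -- off `r + q`. As `u r = v r` and `x` commutes with `u` and `r`, the commutator vanishes on `r`.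
  obtain ⟨u, hu⟩ : ∃ u, u = s + t + f := ⟨_, rfl⟩
  have hus : star u = u := by
    rw [hu, star_add, star_add, hst, hts, hfs, add_comm t s]
  have huu : u * u = 1 := by
    rw [hu]
    simp only [mul_add, add_mul, ss, tt, stt, tss, sf, tf, fs, ft, ff]
    rw [hf]; abel
  have huau : ∀ a ∈ A, u * a * u ∈ A := fun a ha => by
    have : u * a * u = s * a * t + t * a * s + f * a * f := by
      rw [hu]
      simp only [mul_add, add_mul, sas a ha, tat a ha, saf a ha, taf a ha, fas a ha, fat a ha]
      abel
    rw [this]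
    exact add_mem (add_mem (sat a ha) (tas a ha)) (mul_mem (mul_mem hfA ha) hfA)
  have hsM : s ∈ M := hs ▸ mul_mem hv (hAM hr)
  have huM : u ∈ M := hu ▸ add_mem (add_mem hsM (hst ▸ star_mem hsM)) (hAM hfA)
  have hux := hx u (mem_unitaryNormalizer_iff.2 ⟨huM, by rw [hus, huu], by rw [hus, huu],
    by simpa [hus] using huau, by simpa [hus] using huau⟩)
  have hur : u * r = s := by
    rw [hu, add_mul, add_mul, sr, tr, hf, sub_mul, sub_mul, one_mul, hrr, qr]; abel
  calc (v * x - x * v) * r = v * (x * r) - x * (v * r) := by rw [sub_mul, mul_assoc, mul_assoc]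
    _ = s * x - x * s := by rw [← hxA r hr, ← mul_assoc, ← hs]
    _ = 0 := by rw [← hur, mul_assoc, hxA r hr, ← mul_assoc, hux, mul_assoc, sub_self]

/-- Here `v r` is unitary on the range of `r`, so `v r + (1 - r)` is a normalizing unitary that
agrees with `v` on `r`. -/
theorem commutator_mul_eq_zero_of_invariant (hAM : A ≤ M) (hA : IsAbelianVN A) (hv : v ∈ M)
    (hvA : ∀ a ∈ A, v * a * star v ∈ A) (hvA' : ∀ a ∈ A, star v * a * v ∈ A)
    (hx : ∀ u ∈ unitaryNormalizer M (A : Set (H →L[ℂ] H)), u * x = x * u)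
    (hxA : ∀ a ∈ A, a * x = x * a) {r : H →L[ℂ] H} (hr : r ∈ A) (hrp : IsStarProjection r)
    (hrv : star v * v * r = r) (hinv : v * r * star v = r) : (v * x - x * v) * r = 0 := by
  have hrr : r * r = r := hrp.isIdempotentElem
  have hrs : star r = r := hrp.isSelfAdjoint.star_eq
  have hrv' : r * star v * v = r := by simpa [hrs, mul_assoc] using congrArg star hrv
  obtain ⟨s, hs⟩ : ∃ s, s = v * r := ⟨_, rfl⟩
  obtain ⟨t, ht⟩ : ∃ t, t = r * star v := ⟨_, rfl⟩
  have hst : star s = t := by rw [hs, ht, star_mul, hrs]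
  have sr : s * r = s := by rw [hs, mul_assoc, hrr]
  have rt : r * t = t := by rw [ht, ← mul_assoc, hrr]
  have rs : r * s = s := by
    rw [hs]
    nth_rewrite 1 [← hinv]
    calc v * r * star v * (v * r) = v * (r * star v * v) * r := by simp only [mul_assoc]
      _ = _ := by rw [hrv', mul_assoc, hrr]
  have tr : t * r = t := by simpa [hst, hrs] using congrArg star rs
  have stt : s * t = r := by
    rw [hs, ht, ← mul_assoc, mul_assoc v r r, hrr, hinv]
  have tss : t * s = r := by
    rw [hs, ht, ← mul_assoc, hrv', hrr]
  obtain ⟨f, hf⟩ : ∃ f, f = 1 - r := ⟨_, rfl⟩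
  have hfA : f ∈ A := hf ▸ sub_mem (one_mem A) hr
  have sf : s * f = 0 := by rw [hf, mul_sub, mul_one, sr, sub_self]
  have tf : t * f = 0 := by rw [hf, mul_sub, mul_one, tr, sub_self]
  have fs : f * s = 0 := by rw [hf, sub_mul, one_mul, rs, sub_self]
  have ft : f * t = 0 := by rw [hf, sub_mul, one_mul, rt, sub_self]
  have ff : f * f = f := by rw [hf]; simp [mul_sub, sub_mul, hrr]
  have hfs : star f = f := by rw [hf]; simp [hrs]
  obtain ⟨u, hu⟩ : ∃ u, u = s + f := ⟨_, rfl⟩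
  have hus : star u = t + f := by rw [hu, star_add, hst, hfs]
  have h1 : star u * u = 1 := by
    rw [hus, hu]; simp only [mul_add, add_mul, tss, tf, fs, ff]; rw [hf]; abel
  have h2 : u * star u = 1 := by
    rw [hus, hu]; simp only [mul_add, add_mul, stt, sf, ft, ff]; rw [hf]; abel
  have hcf : ∀ a ∈ A, ∀ y z : H →L[ℂ] H, y * f = 0 → f * z = 0 →
      y * a * f = 0 ∧ f * a * z = 0 := fun a ha y z hy hz =>
    ⟨by rw [mul_assoc, hA a ha f hfA, ← mul_assoc, hy, zero_mul],
      by rw [hA f hfA a ha, mul_assoc, hz, mul_zero]⟩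
  have h3 : ∀ a ∈ A, u * a * star u ∈ A := fun a ha => by
    have : u * a * star u = v * (r * a * r) * star v + f * a * f := by
      rw [hus, hu]
      simp only [mul_add, add_mul, (hcf a ha s t sf ft).1, (hcf a ha s t sf ft).2]
      rw [hs, ht]; simp only [mul_assoc]; abel
    rw [this]
    exact add_mem (hvA _ (mul_mem (mul_mem hr ha) hr)) (mul_mem (mul_mem hfA ha) hfA)
  have h4 : ∀ a ∈ A, star u * a * u ∈ A := fun a ha => by
    have : star u * a * u = r * (star v * a * v) * r + f * a * f := by
      rw [hus, hu]
      simp only [mul_add, add_mul, (hcf a ha t s tf fs).1, (hcf a ha t s tf fs).2]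
      rw [hs, ht]; simp only [mul_assoc]; abel
    rw [this]
    exact add_mem (mul_mem (mul_mem hr (hvA' a ha)) hr) (mul_mem (mul_mem hfA ha) hfA)
  have huM : u ∈ M := hu ▸ add_mem (hs ▸ mul_mem hv (hAM hr)) (hAM hfA)
  have hux := hx u (mem_unitaryNormalizer_iff.2 ⟨huM, h1, h2, h3, h4⟩)
  have hur : u * r = s := by rw [hu, add_mul, sr, hf, sub_mul, one_mul, hrr]; abel
  calc (v * x - x * v) * r = v * (x * r) - x * (v * r) := by rw [sub_mul, mul_assoc, mul_assoc]
    _ = s * x - x * s := by rw [← hxA r hr, ← mul_assoc, ← hs]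
    _ = 0 := by rw [← hur, mul_assoc, hxA r hr, ← mul_assoc, hux, mul_assoc, sub_self]

/-- A partial isometry normalizing an abelian von Neumann subalgebra lies in the von Neumann
algebra generated by the normalizing unitaries. -/
theorem commute_of_partialIsometry (hAM : A ≤ M) (hA : IsAbelianVN A) (hv : v ∈ M)
    (hvA : ∀ a ∈ A, v * a * star v ∈ A) (hvA' : ∀ a ∈ A, star v * a * v ∈ A)
    (hvv : v * star v * v = v)
    (hx : ∀ u ∈ unitaryNormalizer M (A : Set (H →L[ℂ] H)), u * x = x * u)
    (hxA : ∀ a ∈ A, a * x = x * a) : v * x = x * v := by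
  obtain ⟨T, hT⟩ : ∃ T, T = v * x - x * v := ⟨_, rfl⟩
  obtain ⟨p, hp⟩ : ∃ p, p = star v * v := ⟨_, rfl⟩
  have hpA : p ∈ A := by simpa [hp] using hvA' 1 (one_mem A)
  have vp : v * p = v := by rw [hp, ← mul_assoc, hvv]
  have hps : star p = p := by rw [hp, star_mul, star_star]
  have pv : p * star v = star v := by simpa [hps] using congrArg star vp
  have hpp : p * p = p := by
    nth_rewrite 1 [hp]; rw [mul_assoc, vp, hp]
  -- `R` is the largest projection of `A` on which the commutator `T` vanishes, and `e` below is the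
  -- rest of `p`. So `T` kills no nonzero element of `A` under `e` (`hzero`), and the aim is `T e =
  -- 0`.
  obtain ⟨R, hRA, hRp, hR1, hR2⟩ := exists_supportProjection A
    (S := {r | r ∈ A ∧ T * r = 0}) (fun r hr => hr.1)
  have hTR : T * R = 0 := hR2 T fun r hr => hr.2
  have hRR : R * R = R := hRp.isIdempotentElem
  have hRs : star R = R := hRp.isSelfAdjoint.star_eq
  obtain ⟨e, he⟩ : ∃ e, e = p - p * R := ⟨_, rfl⟩
  have hpR : p * R = R * p := hA p hpA R hRA
  have heA : e ∈ A := he ▸ sub_mem hpA (mul_mem hpA hRA)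
  have heR : e * R = 0 := by rw [he, sub_mul, mul_assoc, hRR, sub_self]
  have hep : p * e = e := by rw [he, mul_sub, ← mul_assoc, hpp]
  have hee : IsStarProjection e := by
    refine ⟨?_, ?_⟩
    · change e * e = e
      nth_rewrite 2 [he]
      rw [mul_sub, hpR, ← mul_assoc, heR, zero_mul, sub_zero, hA e heA p hpA, hep]
    · rw [IsSelfAdjoint, he, star_sub, star_mul, hps, hRs, hpR]
  have hee' : e * e = e := hee.isIdempotentElem
  have hes : star e = e := hee.isSelfAdjoint.star_eq
  have hzero : ∀ s ∈ A, T * s = 0 → e * s = s → s = 0 := by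
    intro s hs hTs hse
    rw [← hse, ← hR1 s ⟨hs, hTs⟩, ← mul_assoc, heR, zero_mul]
  obtain ⟨q, hq⟩ : ∃ q, q = v * e * star v := ⟨_, rfl⟩
  have hqA : q ∈ A := hq ▸ hvA e heA
  have hqs : star q = q := by rw [hq, star_mul, star_mul, star_star, hes, mul_assoc]
  have hqq : q * q = q := by
    rw [hq]
    calc v * e * star v * (v * e * star v) = v * e * ((star v * v) * e) * star v := by
          simp only [mul_assoc]
      _ = _ := by rw [← hp, hep, mul_assoc v, hee']
  have hvq : v * star v * q = q := by
    rw [hq]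
    calc v * star v * (v * e * star v) = v * star v * v * e * star v := by simp only [mul_assoc]
      _ = _ := by rw [hvv]
  have hqe : q * e = e * q := hA q hqA e heA
  -- The part `f` of `q` off `e` pulls back to a projection `s` under `e` with `v s v* = f`
  -- orthogonal to `s`. The orthogonal case gives `T s = 0`, so `s = 0` and `f = 0`.
  have hle : q * e = q := by
    obtain ⟨f, hf⟩ : ∃ f, f = q - q * e := ⟨_, rfl⟩
    have hfA : f ∈ A := hf ▸ sub_mem hqA (mul_mem hqA heA)
    have hfe : f * e = 0 := by rw [hf, sub_mul, mul_assoc, hee', sub_self]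
    have hqf : q * f = f := by rw [hf, mul_sub, ← mul_assoc, hqq]
    have hff : f * f = f := by
      nth_rewrite 2 [hf]
      rw [mul_sub, hqe, ← mul_assoc, hfe, zero_mul, sub_zero, hA f hfA q hqA, hqf]
    have hfs : star f = f := by rw [hf, star_sub, star_mul, hqs, hes, hqe]
    have hvf : v * star v * f = f := by rw [← hqf, ← mul_assoc, hvq]
    have hfv : f * (v * star v) = f := by
      simpa [hfs] using congrArg star hvf
    obtain ⟨s, hs⟩ : ∃ s, s = star v * f * v := ⟨_, rfl⟩
    have hsA : s ∈ A := hs ▸ hvA' f hfA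
    have hvs : v * s * star v = f := by
      rw [hs]
      calc v * (star v * f * v) * star v = v * star v * f * (v * star v) := by
            simp only [mul_assoc]
        _ = f := by rw [hvf, hfv]
    have hse : s * e = s := by
      have h1 : f * v = f * v * e := by
        have : f = f * q := by rw [hA f hfA q hqA, hqf]
        nth_rewrite 1 [this]
        rw [hq]
        calc f * (v * e * star v) * v = f * v * (e * (star v * v)) := by simp only [mul_assoc]
          _ = _ := by rw [← hp, hA e heA p hpA, hep]
      rw [hs, mul_assoc (star v) f v, mul_assoc, ← h1]
    have hsp : IsStarProjection s := by
      refine ⟨?_, ?_⟩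
      · change s * s = s
        nth_rewrite 1 [hs]
        rw [hs]
        calc star v * f * v * (star v * f * v) = star v * f * (v * star v * f) * v := by
              simp only [mul_assoc]
          _ = _ := by rw [hvf, mul_assoc (star v), hff]
      · rw [IsSelfAdjoint, hs, star_mul, star_mul, star_star, hfs, mul_assoc]
    have hps' : star v * v * s = s := by
      rw [← hp, hs, ← mul_assoc, ← mul_assoc, pv]
    have hTs : T * s = 0 := by
      rw [hT]
      refine commutator_mul_eq_zero_of_orthogonal hAM hA hv hvA hvA' hx hxA hsA hsp hps' ?_
      rw [hvs, ← hse, hA s hsA e heA, ← mul_assoc, hfe, zero_mul]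
    have hs0 := hzero s hsA hTs (by rw [hA e heA s hsA, hse])
    have hf0 : f = 0 := by rw [← hvs, hs0, mul_zero, zero_mul]
    rw [hf, sub_eq_zero] at hf0
    exact hf0.symm
  -- Now `q ≤ e`, and `v` carries `e - q` under `q`, hence to a projection orthogonal to `e - q`;
  -- the orthogonal case applies again.
  have hinv : q = e := by
    obtain ⟨s, hs⟩ : ∃ s, s = e - q := ⟨_, rfl⟩
    have hsA : s ∈ A := hs ▸ sub_mem heA hqA
    have hes' : e * s = s := by rw [hs, mul_sub, hee', ← hqe, hle]
    have hsp : IsStarProjection s := by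
      refine ⟨?_, ?_⟩
      · change s * s = s
        rw [hs]
        simp only [mul_sub, sub_mul, hee', hqq, hle, ← hqe]
        abel
      · rw [IsSelfAdjoint, hs, star_sub, hes, hqs]
    obtain ⟨m, hm⟩ : ∃ m, m = v * s * star v := ⟨_, rfl⟩
    have hmq : m * q = m := by
      rw [hm, hq]
      calc v * s * star v * (v * e * star v) = v * (s * (star v * v * e)) * star v := by
            simp only [mul_assoc]
        _ = _ := by rw [← hp, hep, hA s hsA e heA, hes']
    have hTs : T * s = 0 := by
      rw [hT]
      refine commutator_mul_eq_zero_of_orthogonal hAM hA hv hvA hvA' hx hxA hsA hsp ?_ ?_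
      · rw [← hp, ← hes', ← mul_assoc, hep]
      · rw [← hm, ← hmq, hs, mul_assoc, mul_sub, hle, hqq, sub_self, mul_zero]
    have hs0 := hzero s hsA hTs hes'
    rw [hs, sub_eq_zero] at hs0
    exact hs0.symm
  have hTe : T * e = 0 := by
    rw [hT]
    exact commutator_mul_eq_zero_of_invariant hAM hA hv hvA hvA' hx hxA heA hee
      (by rw [← hp, hep]) (by rw [← hq, hinv])
  have he0 := hzero e heA hTe hee'
  rw [he, sub_eq_zero] at he0
  have hTp : T * p = T := by
    rw [hT, sub_mul, mul_assoc, ← hxA p hpA, ← mul_assoc, vp, mul_assoc, vp]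
  have : T = 0 := by rw [← hTp, he0, hpR, ← mul_assoc, hTR, zero_mul]
  rw [hT, sub_eq_zero] at this
  exact this

end PartialIsometry

/-- An element of `M` normalizing an abelian von Neumann subalgebra `A` commutes with everything
that commutes with the normalizing unitaries of `A`. -/
theorem commute_of_normalizes {M A : VonNeumannAlgebra H} {n x : H →L[ℂ] H} (hAM : A ≤ M)
    (hA : IsAbelianVN A) (hn : n ∈ M) (hnA : ∀ a ∈ A, n * a * star n ∈ A)
    (hnA' : ∀ a ∈ A, star n * a * n ∈ A)
    (hx : ∀ u ∈ unitaryNormalizer M (A : Set (H →L[ℂ] H)), u * x = x * u) : n * x = x * n := by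
  have hgen : ∀ y : H →L[ℂ] H,
      (∀ u ∈ unitaryNormalizer M (A : Set (H →L[ℂ] H)), u * y = y * u) →
      ∀ a ∈ A, a * y = y * a := fun y hy a ha =>
    (commute_of_mem (le_generatedVN_unitaryNormalizer hAM ha)
      (mem_commutant_generatedVN fun u hu =>
        ⟨hy u hu, hy _ (star_mem_unitaryNormalizer hu)⟩)).symm
  -- This says only that the commutator `T` of `n` and `y` vanishes on the range of `n*`; the kernel
  -- of `n` is dealt with at the end.
  have main : ∀ y : H →L[ℂ] H,
      (∀ u ∈ unitaryNormalizer M (A : Set (H →L[ℂ] H)), u * y = y * u) →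
      n * y * star n = y * n * star n := by
    intro y hy
    have hyA := hgen y hy
    obtain ⟨T, hT⟩ : ∃ T, T = n * y - y * n := ⟨_, rfl⟩
    obtain ⟨k, hk⟩ : ∃ k, k = star n * n := ⟨_, rfl⟩
    have hkA : k ∈ A := by simpa [hk] using hnA' 1 (one_mem A)
    have hks : IsSelfAdjoint k := hk ▸ IsSelfAdjoint.star_mul_self n
    have hk0 : 0 ≤ k := hk ▸ star_mul_self_nonneg n
    -- The polar decomposition is cut away from zero: on the support `r` of `(k - ε)₊` the element
    -- `g` inverts `√k`, so `w = n g r` is a partial isometry normalizing `A`.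
    have hε : ∀ ε : ℝ, 0 < ε → T * cfc (fun t : ℝ => max (t - ε) 0) k = 0 := by
      intro ε hε
      obtain ⟨b, hb⟩ : ∃ b, b = cfc (fun t : ℝ => max (t - ε) 0) k := ⟨_, rfl⟩
      obtain ⟨g, hg⟩ : ∃ g, g = cfc (fun t : ℝ => (√(max t ε))⁻¹) k := ⟨_, rfl⟩
      obtain ⟨h, hh⟩ : ∃ h, h = cfc (fun t : ℝ => √(max t ε)) k := ⟨_, rfl⟩
      have hpos : ∀ t : ℝ, 0 < √(max t ε) := fun t => Real.sqrt_pos.2 (lt_max_of_lt_right hε)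
      have hgc : Continuous fun t : ℝ => (√(max t ε))⁻¹ :=
        Continuous.inv₀ (by fun_prop) fun t => (hpos t).ne'
      have hbA : b ∈ A := hb ▸ cfc_mem_vN A _ hkA
      have hgA : g ∈ A := hg ▸ cfc_mem_vN A _ hkA
      have hhA : h ∈ A := hh ▸ cfc_mem_vN A _ hkA
      have hgs : star g = g := by
        rw [hg]; exact (cfc_predicate (p := IsSelfAdjoint) _ k).star_eq
      have hgh : g * h = 1 := by
        rw [hg, hh, ← cfc_mul _ _ k hgc.continuousOn, ← cfc_one ℝ k]
        exact cfc_congr fun t _ => inv_mul_cancel₀ (hpos t).ne'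
      have hgkg : g * k * g * b = b := by
        have hid : k = cfc (fun t : ℝ => t) k := (cfc_id' ℝ k).symm
        rw [hg, hb]
        nth_rewrite 2 [hid]
        rw [← cfc_mul _ _ k hgc.continuousOn, ← cfc_mul _ _ k (by fun_prop) hgc.continuousOn,
          ← cfc_mul _ _ k (by fun_prop)]
        refine cfc_congr fun t _ => ?_
        rcases le_total t ε with h | h
        · simp [max_eq_right (sub_nonpos.2 h)]
        · have h1 := hpos t
          have h2 : √(max t ε) * √(max t ε) = t := by
            rw [max_eq_left h, Real.mul_self_sqrt (hε.le.trans h)]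
          have h3 : (√(max t ε))⁻¹ * t * (√(max t ε))⁻¹ = 1 := by
            field_simp
            rw [sq, h2]
          change (√(max t ε))⁻¹ * t * (√(max t ε))⁻¹ * max (t - ε) 0 = _
          rw [h3, one_mul]
      obtain ⟨r, hrA, hrp, hr1, hr2⟩ := exists_supportProjection A (S := {b}) (by simpa using hbA)
      have hrr : r * r = r := hrp.isIdempotentElem
      have hrs : star r = r := hrp.isSelfAdjoint.star_eq
      have hgr : g * k * g * r = r := by
        have := hr2 (g * k * g - 1) fun z hz => by
          rw [Set.mem_singleton_iff.1 hz, sub_mul, one_mul, hgkg, sub_self]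
        rwa [sub_mul, one_mul, sub_eq_zero] at this
      obtain ⟨w, hw⟩ : ∃ w, w = n * g * r := ⟨_, rfl⟩
      have hws : star w = r * g * star n := by
        rw [hw, star_mul, star_mul, hgs, hrs, mul_assoc]
      have hww : star w * w = r := by
        rw [hws, hw]
        calc r * g * star n * (n * g * r) = r * (g * (star n * n) * g * r) := by
              simp only [mul_assoc]
          _ = r := by rw [← hk, hgr, hrr]
      have hwr : w * r = w := by rw [hw, mul_assoc, hrr]
      have hgrA : g * r ∈ A := mul_mem hgA hrA
      have hrgA : r * g ∈ A := mul_mem hrA hgA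
      have hwy : w * y = y * w := by
        refine commute_of_partialIsometry hAM hA (hw ▸ mul_mem (mul_mem hn (hAM hgA)) (hAM hrA))
          (fun a ha => ?_) (fun a ha => ?_) (by rw [mul_assoc, hww, hwr]) hy hyA
        · have := hnA _ (mul_mem (mul_mem hgrA ha) hrgA)
          rw [hws, hw]; simpa only [mul_assoc] using this
        · have := mul_mem (mul_mem hrgA (hnA' a ha)) hgrA
          rw [hws, hw]; simpa only [mul_assoc] using this
      have hnr : n * r = w * h := by
        rw [hw, mul_assoc _ r h, hA r hrA h hhA, ← mul_assoc, mul_assoc n g h, hgh, mul_one]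
      have hTr : T * r = 0 := by
        rw [hT, sub_mul, mul_assoc, ← hyA r hrA, ← mul_assoc, mul_assoc y, hnr, mul_assoc w,
          hyA h hhA, ← mul_assoc, hwy, mul_assoc, sub_self]
      rw [← hb, ← hr1 b rfl, ← mul_assoc, hTr, zero_mul]
    have hTk : T * k = 0 := by
      rw [← norm_le_zero_iff]
      refine le_of_forall_pos_le_add fun δ hδ => ?_
      rw [zero_add]
      have hpos : 0 < δ / (‖T‖ + 1) := by positivity
      have h1 : ‖k - cfc (fun t : ℝ => max (t - δ / (‖T‖ + 1)) 0) k‖ ≤ δ / (‖T‖ + 1) := by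
        nth_rewrite 1 [← cfc_id' ℝ k]
        rw [← cfc_sub _ _ k]
        refine norm_cfc_le hpos.le fun t ht => ?_
        have ht0 : 0 ≤ t := spectrum_nonneg_of_nonneg hk0 ht
        rw [Real.norm_eq_abs, abs_le]
        rcases le_total t (δ / (‖T‖ + 1)) with h | h
        · rw [max_eq_right (sub_nonpos.2 h)]; constructor <;> linarith
        · rw [max_eq_left (sub_nonneg.2 h)]; constructor <;> linarith
      calc ‖T * k‖ = ‖T * (k - cfc (fun t : ℝ => max (t - δ / (‖T‖ + 1)) 0) k)‖ := by
            rw [mul_sub, hε _ hpos, sub_zero]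
        _ ≤ ‖T‖ * (δ / (‖T‖ + 1)) := (norm_mul_le _ _).trans (by gcongr)
        _ ≤ (‖T‖ + 1) * (δ / (‖T‖ + 1)) := by gcongr; linarith
        _ = δ := by field_simp
    have hTn : T * star n = 0 := by
      rw [← CStarRing.mul_star_self_eq_zero_iff, star_mul, star_star]
      calc T * star n * (n * star T) = T * (star n * n) * star T := by simp only [mul_assoc]
        _ = 0 := by rw [← hk, hTk, zero_mul]
    rwa [hT, sub_mul, sub_eq_zero] at hTn
  have hxs : ∀ u ∈ unitaryNormalizer M (A : Set (H →L[ℂ] H)), u * star x = star x * u := by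
    intro u hu
    have := congrArg star (hx _ (star_mem_unitaryNormalizer hu))
    simpa using this.symm
  -- Expanding `(n x - x n)(n x - x n)*` leaves four terms, which cancel by `main` at `x`, `x*` and
  -- `x x*`.
  have e1 := main x hx
  have e2 := main (star x) hxs
  have e3 := main (x * star x) fun u hu => by
    rw [← mul_assoc, hx u hu, mul_assoc, hxs u hu, mul_assoc]
  rw [← sub_eq_zero, ← CStarRing.mul_star_self_eq_zero_iff]
  have f1 : n * x * star n * star x = x * n * star n * star x := by rw [e1]
  have f2 : x * (n * star x * star n) = x * (star x * n * star n) := by rw [e2]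
  simp only [star_sub, star_mul, mul_sub, sub_mul]
  simp only [mul_assoc] at e3 f1 f2 ⊢
  rw [e3, f1, f2]
  abel

/-! ### Weak density and normalizers of the bicommutant -/

/-- With `P` the projection, `S (P u)` lies in `K` and `S u - S (P u)` is orthogonal to `K`, by
invariance under the adjoint `S'`. Stating adjointness on differences avoids asking for linearity.
-/
theorem starProjection_commute {E : Type*} [NormedAddCommGroup E] [InnerProductSpace ℂ E]
    (K : Submodule ℂ E) [K.HasOrthogonalProjection] {S S' : E → E}
    (hadj : ∀ u v w, inner ℂ (S u - S v) w = inner ℂ (u - v) (S' w)) (hS : ∀ u ∈ K, S u ∈ K)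
    (hS' : ∀ u ∈ K, S' u ∈ K) (u : E) : K.starProjection (S u) = S (K.starProjection u) := by
  refine Submodule.eq_starProjection_of_mem_of_inner_eq_zero
    (hS _ (K.starProjection_apply_mem u)) fun w hw => ?_
  rw [hadj]
  exact K.starProjection_inner_eq_zero u _ (hS' w hw)

/-- Weak density of a nondegenerate `*`-algebra of operators in its double commutant, tested on
functionals given by two pairs of vectors. -/
theorem inner_add_inner_eq_zero_of_mem_generatedVN {C : NonUnitalStarSubalgebra ℂ (H →L[ℂ] H)}
    (hC : ∀ ξ : H, (∀ c ∈ C, c ξ = 0) → ξ = 0) {a : H →L[ℂ] H}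
    (ha : a ∈ generatedVN (C : Set (H →L[ℂ] H))) {ξ₁ ξ₂ η₁ η₂ : H}
    (h : ∀ c ∈ C, inner ℂ η₁ (c ξ₁) + inner ℂ η₂ (c ξ₂) = 0) :
    inner ℂ η₁ (a ξ₁) + inner ℂ η₂ (a ξ₂) = 0 := by
  let E := WithLp 2 (H × H)
  let e : E ≃L[ℂ] H × H := WithLp.prodContinuousLinearEquiv 2 ℂ H H
  let D : (H →L[ℂ] H) → E →L[ℂ] E := fun b =>
    e.symm.toContinuousLinearMap ∘L (b.prodMap b) ∘L e.toContinuousLinearMap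
  let i₁ : H →L[ℂ] E := e.symm.toContinuousLinearMap ∘L ContinuousLinearMap.inl ℂ H H
  let i₂ : H →L[ℂ] E := e.symm.toContinuousLinearMap ∘L ContinuousLinearMap.inr ℂ H H
  let π₁ : E →L[ℂ] H := ContinuousLinearMap.fst ℂ H H ∘L e.toContinuousLinearMap
  let π₂ : E →L[ℂ] H := ContinuousLinearMap.snd ℂ H H ∘L e.toContinuousLinearMap
  have hinner : ∀ u w : E, inner ℂ u w = inner ℂ (π₁ u) (π₁ w) + inner ℂ (π₂ u) (π₂ w) :=
    fun u w => rfl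
  have hπD₁ : ∀ b u, π₁ (D b u) = b (π₁ u) := fun b u => rfl
  have hπD₂ : ∀ b u, π₂ (D b u) = b (π₂ u) := fun b u => rfl
  have hext : ∀ u w : E, π₁ u = π₁ w → π₂ u = π₂ w → u = w := fun u w h1 h2 =>
    e.injective (Prod.ext h1 h2)
  have hsplit : ∀ u : E, u = i₁ (π₁ u) + i₂ (π₂ u) := fun u =>
    hext _ _ (by change _ = π₁ u + 0; rw [add_zero]) (by change _ = 0 + π₂ u; rw [zero_add])
  have hDi₁ : ∀ b x, D b (i₁ x) = i₁ (b x) := fun b x =>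
    hext _ _ rfl (by change b 0 = 0; exact map_zero b)
  have hDi₂ : ∀ b x, D b (i₂ x) = i₂ (b x) := fun b x =>
    hext _ _ (by change b 0 = 0; exact map_zero b) rfl
  let ζ : E := e.symm (ξ₁, ξ₂)
  let η : E := e.symm (η₁, η₂)
  -- The bicommutant argument on `H ⊕ H`: the projection onto the closure of `{D c ζ}` commutes with
  -- every `D c`, so its matrix entries commute with `C`, hence with `a`, and it commutes with `D a`
  -- as well.
  let K₀ : Submodule ℂ E := Submodule.span ℂ {u | ∃ c ∈ C, u = D c ζ}
  let K : Submodule ℂ E := K₀.topologicalClosure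
  have hKc : IsClosed (K : Set E) := K₀.isClosed_topologicalClosure
  have : CompleteSpace K := hKc.completeSpace_coe
  have hDK : ∀ c ∈ C, ∀ u ∈ K, D c u ∈ K := by
    intro c hc u hu
    have h0 : K₀ ≤ K.comap (D c).toLinearMap := by
      refine Submodule.span_le.2 ?_
      rintro _ ⟨d, hd, rfl⟩
      exact K₀.le_topologicalClosure (Submodule.subset_span ⟨c * d, mul_mem hc hd, rfl⟩)
    exact K₀.topologicalClosure_minimal h0 (hKc.preimage (D c).continuous) hu
  have hPD : ∀ c ∈ C, ∀ u, K.starProjection (D c u) = D c (K.starProjection u) := by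
    intro c hc
    refine starProjection_commute K (S := D c) (S' := D (star c)) (fun u v w => ?_) (hDK c hc)
      (hDK _ (star_mem hc))
    rw [← map_sub, hinner, hinner, hπD₁, hπD₂, hπD₁, hπD₂, ContinuousLinearMap.star_eq_adjoint,
      ContinuousLinearMap.adjoint_inner_right, ContinuousLinearMap.adjoint_inner_right]
  have hentry : ∀ (π : E →L[ℂ] H) (i : H →L[ℂ] E), (∀ b u, π (D b u) = b (π u)) →
      (∀ b x, D b (i x) = i (b x)) → ∀ x, π (K.starProjection (i (a x))) =
        a (π (K.starProjection (i x))) := by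
    intro π i hπ hi x
    have hcomm : ∀ c ∈ C, c * (π ∘L K.starProjection ∘L i) = (π ∘L K.starProjection ∘L i) * c := by
      intro c hc
      ext y
      change c (π (K.starProjection (i y))) = π (K.starProjection (i (c y)))
      rw [← hi, hPD c hc, hπ]
    exact congrArg (fun t : H →L[ℂ] H => t x) (mem_generatedVN.1 ha (π ∘L K.starProjection ∘L i)
      fun s hs => ⟨hcomm s hs, hcomm _ (star_mem hs)⟩)
  have hPDa : ∀ u, K.starProjection (D a u) = D a (K.starProjection u) := by
    intro u
    rw [hsplit u, map_add, hDi₁, hDi₂, map_add, map_add, map_add]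
    refine hext _ _ ?_ ?_
    · rw [map_add, map_add, hπD₁, hπD₁, hentry π₁ i₁ hπD₁ hDi₁, hentry π₁ i₂ hπD₁ hDi₂]
    · rw [map_add, map_add, hπD₂, hπD₂, hentry π₂ i₁ hπD₂ hDi₁, hentry π₂ i₂ hπD₂ hDi₂]
  -- Nondegeneracy replaces a unit in `C`: every `D c` annihilates `ζ - Pζ`, so `ζ` lies in `K`.
  have hζ : K.starProjection ζ = ζ := by
    have h0 : ∀ c ∈ C, D c (ζ - K.starProjection ζ) = 0 := by
      intro c hc
      rw [map_sub, ← hPD c hc, Submodule.starProjection_eq_self_iff.2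
        (K₀.le_topologicalClosure (Submodule.subset_span ⟨c, hc, rfl⟩)), sub_self]
    have h1 : ζ - K.starProjection ζ = 0 :=
      hext _ _
        ((hC _ fun c hc => by rw [← hπD₁, h0 c hc, map_zero]).trans (map_zero π₁).symm)
        ((hC _ fun c hc => by rw [← hπD₂, h0 c hc, map_zero]).trans (map_zero π₂).symm)
    exact (sub_eq_zero.1 h1).symm
  have hmem : D a ζ ∈ K := by
    rw [← hζ, ← hPDa]; exact K.starProjection_apply_mem _
  have hker : K ≤ (innerSL ℂ η).ker := by
    refine K₀.topologicalClosure_minimal ?_ (innerSL ℂ η).isClosed_ker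
    refine Submodule.span_le.2 ?_
    rintro _ ⟨c, hc, rfl⟩
    exact h c hc
  exact hker hmem

/-- A matrix coefficient of the commutator of `y` with `n b n*` is a sum of two coefficients of `b`,
which is why the density lemma carries two pairs of vectors. It vanishes for `b ∈ C`, hence for `b ∈
C''`. -/
theorem conj_mem_generatedVN {C : NonUnitalStarSubalgebra ℂ (H →L[ℂ] H)}
    (hC : ∀ ξ : H, (∀ c ∈ C, c ξ = 0) → ξ = 0) {n : H →L[ℂ] H}
    (hn : ∀ c ∈ C, n * c * star n ∈ C) {a : H →L[ℂ] H}
    (ha : a ∈ generatedVN (C : Set (H →L[ℂ] H))) :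
    n * a * star n ∈ generatedVN (C : Set (H →L[ℂ] H)) := by
  refine mem_generatedVN.2 fun y hy => ?_
  have key : ∀ (b : H →L[ℂ] H) (ξ η : H),
      inner ℂ η ((y * (n * b * star n)) ξ) - inner ℂ η ((n * b * star n * y) ξ) =
        inner ℂ (star n (star y η)) (b (star n ξ)) + inner ℂ (-(star n η)) (b (star n (y ξ))) := by
    intro b ξ η
    simp only [ContinuousLinearMap.star_eq_adjoint, inner_neg_left,
      ContinuousLinearMap.adjoint_inner_left]
    rw [← sub_eq_add_neg]
    rfl
  ext ξ
  refine ext_inner_left ℂ fun η => ?_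
  rw [← sub_eq_zero, key]
  refine inner_add_inner_eq_zero_of_mem_generatedVN hC ha fun c hc => ?_
  rw [← key, (hy _ (hn c hc)).1, sub_self]

/-! ### Regular subalgebras of strongly dense C*-subalgebras -/

/-- Commuting with a fixed operator survives norm limits and strong limits, so it passes from the
normalizer to `B` and then to `M`. -/
theorem le_generatedVN_cstarNormalizer {M : VonNeumannAlgebra H}
    {B C : NonUnitalStarSubalgebra ℂ (H →L[ℂ] H)} (hB : IsStronglyDenseCStarSubalgebra M B)
    (hBC : IsRegularCStar B C) : M ≤ generatedVN (cstarNormalizer B C) := by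
  let W := generatedVN (cstarNormalizer B C)
  have hBW : (B : Set (H →L[ℂ] H)) ⊆ W := by
    have h1 : NonUnitalStarAlgebra.adjoin ℂ (cstarNormalizer B C) ≤
        W.toStarSubalgebra.toNonUnitalStarSubalgebra :=
      NonUnitalStarAlgebra.adjoin_le (subset_generatedVN _)
    have h2 := NonUnitalStarSubalgebra.topologicalClosure_minimal _ h1 (isClosed_vN W)
    rw [hBC.2] at h2
    exact h2
  intro m hm
  refine mem_of_commute fun y hy => ?_
  let Z : Set (PointwiseConvergenceCLM (RingHom.id ℂ) H H) := {z | ∀ ξ, y (z ξ) = z (y ξ)}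
  have hZ : IsClosed Z := by
    have : Z = ⋂ ξ, {z | y (z ξ) = z (y ξ)} := by ext; simp [Z]
    rw [this]
    exact isClosed_iInter fun ξ => isClosed_eq
      (y.continuous.comp (continuous_eval_const ξ)) (continuous_eval_const (y ξ))
  have hsub : ContinuousLinearMap.toPointwiseConvergenceCLM ℂ (RingHom.id ℂ) H H ''
      (B : Set (H →L[ℂ] H)) ⊆ Z := by
    rintro _ ⟨b, hb, rfl⟩ ξ
    exact congrArg (fun t : H →L[ℂ] H => t ξ) (commute_of_mem (hBW hb) hy)
  have hmZ := closure_minimal hsub hZ (hB.2.2 m hm)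
  ext ξ
  exact hmZ ξ

theorem star_mem_cstarNormalizer {B C : NonUnitalStarSubalgebra ℂ (H →L[ℂ] H)} {n : H →L[ℂ] H}
    (hn : n ∈ cstarNormalizer B C) : star n ∈ cstarNormalizer B C :=
  ⟨star_mem hn.1, fun c hc => by simpa using (hn.2 c hc).symm⟩

/-- A regular nonzero `*`-subalgebra of a strongly dense C⋆-subalgebra of a factor acts
nondegenerately. -/
theorem nondegenerate_of_isRegularCStar {M : VonNeumannAlgebra H} (hM : IsFactor M)
    {B C : NonUnitalStarSubalgebra ℂ (H →L[ℂ] H)} (hB : IsStronglyDenseCStarSubalgebra M B)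
    (hBC : IsRegularCStar B C) (hC0 : ∃ c ∈ C, c ≠ 0) {ξ : H} (hξ : ∀ c ∈ C, c ξ = 0) : ξ = 0 := by
  have hCM : (C : Set (H →L[ℂ] H)) ⊆ M := fun c hc => hB.2.1 (hBC.1 hc)
  obtain ⟨e, heA, hep, he1, he2⟩ := exists_supportProjection
    (generatedVN (C : Set (H →L[ℂ] H))) (subset_generatedVN _)
  have hes : star e = e := hep.isSelfAdjoint.star_eq
  -- Since `n d d* n*` lies in `C`, the range of `n d` lies under the support `e` of `C`. Thus
  -- normalizers leave the range of `e` invariant; with adjoints, `e` becomes central.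
  have hne : ∀ n ∈ cstarNormalizer B C, n * e = e * n * e := by
    intro n hn
    have h1 : (1 - e) * n * e = 0 := by
      refine he2 _ fun d hd => ?_
      rw [← CStarRing.mul_star_self_eq_zero_iff]
      have h2 : e * (n * (d * star d) * star n) = n * (d * star d) * star n :=
        he1 _ (hn.2 _ (mul_mem hd (star_mem hd))).1
      calc (1 - e) * n * d * star ((1 - e) * n * d)
          = (1 - e) * (n * (d * star d) * star n) * star (1 - e) := by
            simp only [star_mul, mul_assoc]
        _ = 0 := by rw [sub_mul, one_mul, h2, sub_self, zero_mul]
    rw [sub_mul, one_mul, sub_mul, sub_eq_zero] at h1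
    exact h1
  have hcomm : ∀ n ∈ cstarNormalizer B C, n * e = e * n := by
    intro n hn
    have h1 := congrArg star (hne _ (star_mem_cstarNormalizer hn))
    simp only [star_mul, star_star, hes] at h1
    exact (hne n hn).trans ((mul_assoc _ _ _).trans h1.symm)
  have heM : e ∈ M := generatedVN_le hCM heA
  have hecomm : e ∈ M.commutant := VonNeumannAlgebra.mem_commutant_iff.2 fun m hm =>
    (mem_generatedVN.1 (le_generatedVN_cstarNormalizer hB hBC hm) e fun n hn =>
      ⟨hcomm n hn, hcomm _ (star_mem_cstarNormalizer hn)⟩).symm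
  obtain ⟨k, hk⟩ := hM.2 e heM hecomm
  obtain ⟨c, hc, hc0⟩ := hC0
  have hk1 : e = 1 := by
    have h1 : (k - 1) • c = 0 := by
      have := he1 c hc
      rw [hk, smul_mul_assoc, one_mul] at this
      rw [sub_smul, one_smul, this, sub_self]
    rcases smul_eq_zero.1 h1 with h | h
    · rw [hk, sub_eq_zero.1 h, one_smul]
    · exact absurd h hc0
  -- The rank-one operator at `ξ` satisfies `T d = 0` for all `d ∈ C`, hence `T e = 0`, and `e = 1`.
  have h0 : InnerProductSpace.rankOne ℂ ξ ξ * e = 0 := he2 _ fun d hd => by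
    ext η
    change inner ℂ ξ (d η) • ξ = 0
    rw [← ContinuousLinearMap.adjoint_inner_left, ← ContinuousLinearMap.star_eq_adjoint,
      hξ _ (star_mem hd), inner_zero_left, zero_smul]
  rw [hk1, mul_one, InnerProductSpace.rankOne_eq_zero, or_self] at h0
  exact h0

theorem le_generatedVN_unitaryNormalizer_of_isRegularCStar {M : VonNeumannAlgebra H}
    (hM : IsFactor M) {B C : NonUnitalStarSubalgebra ℂ (H →L[ℂ] H)}
    (hB : IsStronglyDenseCStarSubalgebra M B) (hBC : IsRegularCStar B C) (hC : IsAbelian C)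
    (hC0 : ∃ c ∈ C, c ≠ 0) :
    M ≤ generatedVN (unitaryNormalizer M
      (generatedVN (C : Set (H →L[ℂ] H)) : Set (H →L[ℂ] H))) := by
  have hCM : (C : Set (H →L[ℂ] H)) ⊆ M := fun c hc => hB.2.1 (hBC.1 hc)
  have hnd : ∀ ξ : H, (∀ c ∈ C, c ξ = 0) → ξ = 0 := fun ξ hξ =>
    nondegenerate_of_isRegularCStar hM hB hBC hC0 hξ
  have hconj : ∀ n ∈ cstarNormalizer B C, ∀ a ∈ generatedVN (C : Set (H →L[ℂ] H)),
      n * a * star n ∈ generatedVN (C : Set (H →L[ℂ] H)) := fun n hn a ha =>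
    conj_mem_generatedVN hnd (fun c hc => (hn.2 c hc).1) ha
  intro m hm
  refine mem_of_commute fun y hy => ?_
  have hyu : ∀ u ∈ unitaryNormalizer M (generatedVN (C : Set (H →L[ℂ] H)) : Set (H →L[ℂ] H)),
      u * y = y * u := fun u hu => (commute_of_mem (subset_generatedVN _ hu) hy).symm
  have hyn : ∀ n ∈ cstarNormalizer B C, n * y = y * n := fun n hn =>
    commute_of_normalizes (generatedVN_le hCM) (isAbelianVN_generatedVN hC) (hB.2.1 hn.1)
      (hconj n hn) (fun a ha => by
        simpa using hconj _ (star_mem_cstarNormalizer hn) a ha) hyu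
  exact mem_generatedVN.1 (le_generatedVN_cstarNormalizer hB hBC hm) y fun n hn =>
    ⟨hyn n hn, hyn _ (star_mem_cstarNormalizer hn)⟩

/-! ### Conclusion from strong solidity -/

/-- In a non-amenable strongly solid II₁ factor, no infinite dimensional abelian `*`-subalgebra
generates a regular von Neumann subalgebra. -/
theorem finiteDimensional_of_generatedVN_unitaryNormalizer {M : VonNeumannAlgebra H}
    (hM : IsTypeIIOneFactor M) (hna : ¬ IsAmenable M) (hss : IsStronglySolid M)
    {C : NonUnitalStarSubalgebra ℂ (H →L[ℂ] H)} (hCM : (C : Set (H →L[ℂ] H)) ⊆ M)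
    (hC : IsAbelian C)
    (hreg : M ≤ generatedVN (unitaryNormalizer M
      (generatedVN (C : Set (H →L[ℂ] H)) : Set (H →L[ℂ] H)))) : FiniteDimensional ℂ C := by
  let A := generatedVN (C : Set (H →L[ℂ] H))
  have hAM : A ≤ M := generatedVN_le hCM
  have hA : IsAbelianVN A := isAbelianVN_generatedVN hC
  have hreg' : generatedVN (unitaryNormalizer M (A : Set (H →L[ℂ] H))) = M :=
    le_antisymm (generatedVN_le fun u hu => hu.1) hreg
  by_contra hfin
  refine hna ?_
  rw [← hreg']
  refine hss A hAM (fun p hp => hfin ?_) (isAmenable_of_isAbelianVN hA)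
  obtain ⟨V, hV, hAV⟩ :=
    exists_finiteDimensional_of_isMinimalProjection hM.1 hM.2.1 hAM hA hreg' hp
  exact Submodule.finiteDimensional_of_le
    (S₁ := C.toNonUnitalSubalgebra.toSubmodule) (S₂ := V) fun c hc => hAV (subset_generatedVN _ hc)

end OpAlg

theorem corollary2p3 {H : Type*} [NormedAddCommGroup H] [InnerProductSpace ℂ H] [CompleteSpace H]
    (M : VonNeumannAlgebra H) (hM : OpAlg.IsTypeIIOneFactor M) (hna : ¬ OpAlg.IsAmenable M)
    (hss : OpAlg.IsStronglySolid M) :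
    (∀ B : NonUnitalStarSubalgebra ℂ (H →L[ℂ] H), OpAlg.IsStronglyDenseCStarSubalgebra M B →
      ¬ ∃ C : NonUnitalStarSubalgebra ℂ (H →L[ℂ] H),
        OpAlg.IsRegularCStar B C ∧ OpAlg.IsAbelian C ∧ ¬ FiniteDimensional ℂ C) ∧
    ¬ ∃ C : NonUnitalStarSubalgebra ℂ (H →L[ℂ] H),
      OpAlg.IsRegularVN M C ∧ OpAlg.IsAbelian C ∧ ¬ FiniteDimensional ℂ C := by
  constructor
  · rintro B hB ⟨C, hBC, hC, hfin⟩
    -- A nonzero element is what forces the support of `C` to be `1` rather than `0`.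
    have hC0 : ∃ c ∈ C, c ≠ 0 := by
      by_contra! h
      have : Subsingleton C := ⟨fun a b => Subtype.ext ((h a a.2).trans (h b b.2).symm)⟩
      exact hfin inferInstance
    exact hfin (OpAlg.finiteDimensional_of_generatedVN_unitaryNormalizer hM hna hss
      (fun c hc => hB.2.1 (hBC.1 hc)) hC
      (OpAlg.le_generatedVN_unitaryNormalizer_of_isRegularCStar hM.1 hB hBC hC hC0))
  · rintro ⟨C, ⟨hCM, hreg⟩, hC, hfin⟩
    refine hfin (OpAlg.finiteDimensional_of_generatedVN_unitaryNormalizer hM hna hss hCM hC ?_)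
    exact hreg.ge.trans
      (OpAlg.generatedVN_mono (OpAlg.unitaryNormalizer_subset_generatedVN M _))
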